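/- Let $n\ge 4$ and let $\mathcal X\subset\mathbb R^2$ be a $GC_n$ set: a set of $\binom{n+2}{2}$ nodes such that Lagrange interpolation at $\mathcal X$ by bivariate polynomials of total degree at most $n$ is unisolvent, and such that the fundamental polynomial of each node (degree at most $n$, equal to $1$ at this node and to $0$ at all the others) is a product of $n$ linear factors. A node uses a line if an equation of the line divides the fundamental polynomial of the node; a line is used if some node uses it. A maximal line is a line through exactly $n+1$ nodes, and a $k_m$-node is a node lying on exactly $k$ maximal lines. Suppose that $\mathcal X$ has defect $3$, that is, exactly $n-1$ maximal lines. Then there are exactly three $0_m$-nodes and each maximal line contains exactly three $1_m$-nodes, and the $0_m$-nodes can be named $O_1,O_2,O_3$, the maximal lines $\lambda_1,\dots,\lambda_{n-1}$, and the $1_m$-nodes on $\lambda_j$ as $A_j^1,A_j^2,A_j^3$ (each object being named once) in such a way that, denoting by $\ell_i^{oo}$ the line through the two $0_m$-nodes other than $O_i$ (the $OO$-lines), (a) $\ell_i^{oo}\cap\lambda_i\cap\mathcal X=\emptyset$ for $i=1,2,3$; (b) if $A_j^r\in\ell_s^{oo}$ then $r=s$. For every such naming put $D_i:=A_i^i$,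 $i=1,2,3$ (the $D$-nodes). Then $A_j^r\in\ell_r^{oo}$ for all $(j,r)$ with $j\ne r$, no $D_i$ lies on an $OO$-line, and for $\{i,j,k\}=\{1,2,3\}$ the nodes $O_i,D_j,D_k$ lie on one line $\ell_i^{dd}$ (the $DD$-lines). For $1\le i<j\le 3$ let $\ell_{ij}$ be the line through $A_i^j$ and $A_j^i$, and for $1\le i\le 3$, $4\le j\le n-1$ let $\ell_i^j$ be the line through $D_i$ and $A_j^i$. The set of used lines of $\mathcal X$ is the union of the following five classes: 1) the maximal lines $\lambda_1,\dots,\lambda_{n-1}$; 2) the $OO$-lines $\ell_i^{oo}$, $1\le i\le 3$; 3) the $DD$-lines $\ell_i^{dd}$, $1\le i\le 3$; 4) the lines $\ell_{ij}$, $1\le i<j\le3$; 5) the lines $\ell_i^j$, $1\le i\le 3$, $4\le j\le n-1$. These five classes are pairwise disjoint, and within each class distinct labels give distinct lines. Moreover, if $\{i,j,k\}=\{1,2,3\}$ then $\ell_{ij}$ does not pass through $D_k$. -/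

import Mathlib

namespace GCSets

/-- The real plane. -/
abbrev Plane : Type := Fin 2 → ℝ

/-- Bivariate real polynomials. -/
abbrev Poly : Type := MvPolynomial (Fin 2) ℝ

/-- A line of the plane: an affine subspace of dimension one. -/
def IsLine (L : AffineSubspace ℝ Plane) : Prop :=
  Module.finrank ℝ L.direction = 1

/-- `f` is a polynomial of degree one whose zero set is `L`. -/
def IsEquationOf (f : Poly) (L : AffineSubspace ℝ Plane) : Prop :=
  f.totalDegree = 1 ∧ ∀ P : Plane, P ∈ L ↔ MvPolynomial.eval P f = 0

/-- `X` is an `n`-correct set: it has `(n + 2).choose 2` nodes, and the Lagrange interpolation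
problem at `X` with polynomials of total degree at most `n` is unisolvent. -/
def IsCorrect (n : ℕ) (X : Finset Plane) : Prop :=
  X.card = (n + 2).choose 2 ∧
    ∀ c : Plane → ℝ, ∃! p : Poly,
      p.totalDegree ≤ n ∧ ∀ A ∈ X, MvPolynomial.eval A p = c A

/-- `p` is an `n`-fundamental polynomial of the node `A` of `X`. -/
def IsFundamental (n : ℕ) (X : Finset Plane) (A : Plane) (p : Poly) : Prop :=
  p.totalDegree ≤ n ∧ MvPolynomial.eval A p = 1 ∧
    ∀ B ∈ X, B ≠ A → MvPolynomial.eval B p = 0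

/-- `X` is a `GC_n` set: it is `n`-correct and the fundamental polynomial of each node is a
product of `n` linear factors. -/
def IsGC (n : ℕ) (X : Finset Plane) : Prop :=
  IsCorrect n X ∧
    ∀ A ∈ X, ∀ p : Poly, IsFundamental n X A p →
      ∃ f : Fin n → Poly, (∀ i, (f i).totalDegree = 1) ∧ p = ∏ i, f i

/-- The node `A` of `X` uses the line `L`: the fundamental polynomial of `A` is the product of
an equation of `L` and a polynomial of degree at most `n - 1`. -/
def Uses (n : ℕ) (X : Finset Plane) (A : Plane) (L : AffineSubspace ℝ Plane) : Prop :=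
  A ∈ X ∧ ∃ p f q : Poly, IsFundamental n X A p ∧ IsEquationOf f L ∧
    q.totalDegree + 1 ≤ n ∧ p = f * q

/-- The used lines of `X`: those used by at least one node. -/
def usedLines (n : ℕ) (X : Finset Plane) : Set (AffineSubspace ℝ Plane) :=
  {L | ∃ A, Uses n X A L}

/-- The maximal lines of `X`: the lines passing through exactly `n + 1` nodes. -/
def maximalLines (n : ℕ) (X : Finset Plane) : Set (AffineSubspace ℝ Plane) :=
  {L | IsLine L ∧ ((X : Set Plane) ∩ (L : Set Plane)).ncard = n + 1}

/-- The defect `n + 2 - #M(X)`. -/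
noncomputable def defect (n : ℕ) (X : Finset Plane) : ℤ :=
  (n : ℤ) + 2 - ((maximalLines n X).ncard : ℤ)

/-- The `k_m`-nodes of `X`: the nodes that belong to exactly `k` maximal lines. -/
def mNodes (k n : ℕ) (X : Finset Plane) : Set Plane :=
  {A | A ∈ X ∧ {L | L ∈ maximalLines n X ∧ A ∈ L}.ncard = k}

/-- The line through the two points of `{P 0, P 1, P 2}` other than `P i` (the indices `i + 1`
and `i + 2` are taken modulo three). -/
def oppositeLine (P : Fin 3 → Plane) (i : Fin 3) : AffineSubspace ℝ Plane :=
  line[ℝ, P (i + 1), P (i + 2)]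

/-- A naming of the maximal lines and of the `0_m`- and `1_m`-nodes of a set of defect three.
The index `Sum.inl i`, `i = 0, 1, 2`, stands for the three distinguished maximal lines
(`λ_1, λ_2, λ_3`), and `Sum.inr j` for the other `n - 4` ones (`λ_4, …, λ_{n-1}`). -/
structure Labelling (n : ℕ) (X : Finset Plane) where
  /-- The maximal lines, each named once. -/
  lam : Fin 3 ⊕ Fin (n - 4) → AffineSubspace ℝ Plane
  lam_injective : Function.Injective lam
  range_lam : Set.range lam = maximalLines n X
  /-- The three `0_m`-nodes, each named once. -/
  O : Fin 3 → Plane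
  O_injective : Function.Injective O
  range_O : Set.range O = mNodes 0 n X
  /-- `A a 0, A a 1, A a 2` are the three `1_m`-nodes on the maximal line `lam a`. -/
  A : Fin 3 ⊕ Fin (n - 4) → Fin 3 → Plane
  A_injective : ∀ a, Function.Injective (A a)
  range_A : ∀ a, Set.range (A a) = {P | P ∈ mNodes 1 n X ∧ P ∈ lam a}
  /-- A `1_m`-node on an `OO`-line carries the number of that line. -/
  A_name : ∀ a r s, A a r ∈ oppositeLine O s → r = s
  /-- The `i`-th distinguished maximal line is one that meets the `i`-th `OO`-line at no node. -/
  lam_name : ∀ i, ∀ P ∈ X, P ∈ oppositeLine O i → P ∉ lam (Sum.inl i)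

namespace Labelling

variable {n : ℕ} {X : Finset Plane} (N : Labelling n X)

/-- The `D`-nodes `D_i = A_i^i`. -/
def D (i : Fin 3) : Plane := N.A (Sum.inl i) i

/-- The `OO`-lines: the `i`-th one passes through the two `0_m`-nodes other than `O_i`. -/
def oo (i : Fin 3) : AffineSubspace ℝ Plane := oppositeLine N.O i

/-- The `DD`-lines: the `i`-th one passes through the two `D`-nodes other than `D_i`. -/
def dd (i : Fin 3) : AffineSubspace ℝ Plane := oppositeLine N.D i

/-- The lines `ℓ_ij`, for distinct `i, j` in `{1, 2, 3}` with third index `k`. The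
`1_m`-nodes on `λ_i` and `λ_j` are `A_i^k, A_j^k` (on the `k`-th `OO`-line), `D_i, D_j` (on the
`k`-th `DD`-line) and the remaining two nodes `A_i^j, A_j^i`, which determine `ℓ_ij`. -/
def ell (i j : Fin 3) : AffineSubspace ℝ Plane :=
  line[ℝ, N.A (Sum.inl i) j, N.A (Sum.inl j) i]

/-- The lines `ℓ_i^j`, for `i` in `{1, 2, 3}` and a nondistinguished maximal line `λ_j`: the
line through `D_i` and the node `A_j^i` at which `λ_j` meets the `i`-th `OO`-line. -/
def ellSup (i : Fin 3) (j : Fin (n - 4)) : AffineSubspace ℝ Plane :=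
  line[ℝ, N.D i, N.A (Sum.inr j) i]

/-- The five classes: the maximal lines, the `OO`-lines, the `DD`-lines, the lines `ℓ_ij` with
`i < j`, and the lines `ℓ_i^j`. -/
def lineClass : Fin 5 → Set (AffineSubspace ℝ Plane) :=
  ![maximalLines n X,
    {L | ∃ i, L = N.oo i},
    {L | ∃ i, L = N.dd i},
    {L | ∃ i j, i < j ∧ L = N.ell i j},
    {L | ∃ i j, L = N.ellSup i j}]

end Labelling

end GCSets

/-! ### Lines of the plane and polynomials of degree one -/

namespace GCSets

open MvPolynomial

/-! Maximal lines can be peeled off. A maximal line belongs to the cover of every node outside it,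
so deleting its nodes lowers the degree by one and keeps the covering property (`GCLike.remove`).
Deleting all `n - 1` of them leaves a triangle of three non-collinear `0_m`-nodes. Keeping one
leaves 6 nodes, hence three `1_m`-nodes on that line. Keeping two leaves 10 = 3 + 3 + 3 + 1 nodes,
so two maximal lines always meet at a node, and no three are concurrent.

These small sets are rigid. In a 6-node set, the two lines avoiding a given `1_m`-node cover the
whole triangle and the other two `1_m`-nodes, so one of these lines is an OO-line
(`exists_mem_oo_of_ne`). Hence at most one `1_m`-node of a maximal line is off the OO-line of its
number. An OO-line carrying its node of every maximal line would have `n + 1` nodes and be maximal,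
so each OO-line misses one (`exists_notMem_oo`). In a 10-node set, the cover belonging to the
intersection node puts two missed nodes on a line with a `0_m`-node (`exists_line_of_notMem`). This
gives the DD-lines, and also shows that each OO-line misses only one node (`eq_of_notMem_oo`), which
is what makes the naming possible.

With the naming at hand, every node on `k` maximal lines has an explicit cover of the others: the
remaining `n - 1 - k` maximal lines and `k + 1` further lines. By unisolvence the product of their
equations is, up to a scalar, the fundamental polynomial, so these are exactly the lines the node
uses (`uses_iff_mem`). Running through the types of nodes yields the five classes. Their
distinctness is incidence geometry, except that an `ell` could coincide with an `ellSup` if it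
passed through the third `D`-node; a linear relation among cubics excludes this (`D_notMem_ell`). -/

theorem isLine_line {P Q : Plane} (h : P ≠ Q) : IsLine line[ℝ, P, Q] := by
  rw [IsLine, direction_affineSpan, vectorSpan_eq_span_vsub_set_left ℝ (Set.mem_insert P {Q})]
  rw [Set.image_pair, vsub_self, Submodule.span_insert_zero]
  exact finrank_span_singleton (vsub_ne_zero.2 h)

theorem IsLine.eq_line {L : AffineSubspace ℝ Plane} (hL : IsLine L) {P Q : Plane} (h : P ≠ Q)
    (hP : P ∈ L) (hQ : Q ∈ L) : line[ℝ, P, Q] = L := by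
  have hle : line[ℝ, P, Q] ≤ L := affineSpan_pair_le_of_mem_of_mem hP hQ
  refine AffineSubspace.eq_of_direction_eq_of_nonempty_of_le ?_
    ⟨P, left_mem_affineSpan_pair ℝ P Q⟩ hle
  exact Submodule.eq_of_le_of_finrank_eq (AffineSubspace.direction_le hle)
    ((isLine_line h).trans hL.symm)

theorem IsLine.eq_of_mem {L M : AffineSubspace ℝ Plane} (hL : IsLine L) (hM : IsLine M)
    {P Q : Plane} (h : P ≠ Q) (hPL : P ∈ L) (hQL : Q ∈ L) (hPM : P ∈ M) (hQM : Q ∈ M) : L = M :=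
  (hL.eq_line h hPL hQL).symm.trans (hM.eq_line h hPM hQM)

theorem IsLine.eq_of_ne {L M : AffineSubspace ℝ Plane} (hL : IsLine L) (hM : IsLine M)
    (h : L ≠ M) {P Q : Plane} (hPL : P ∈ L) (hPM : P ∈ M) (hQL : Q ∈ L) (hQM : Q ∈ M) : P = Q :=
  by_contra fun hPQ => h (hL.eq_of_mem hM hPQ hPL hQL hPM hQM)

theorem IsLine.exists_ne {L : AffineSubspace ℝ Plane} (hL : IsLine L) :
    ∃ P Q, P ≠ Q ∧ P ∈ L ∧ Q ∈ L := by
  obtain ⟨P, hP⟩ : (L : Set Plane).Nonempty := by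
    rw [AffineSubspace.nonempty_iff_ne_bot]
    rintro rfl
    rw [IsLine, AffineSubspace.direction_bot, finrank_bot] at hL
    exact zero_ne_one hL
  obtain ⟨⟨v, hv⟩, hv0, -⟩ := finrank_eq_one_iff'.1 hL
  refine ⟨P, v +ᵥ P, ?_, hP, AffineSubspace.vadd_mem_of_mem_direction hv hP⟩
  intro h
  apply hv0
  have : v = 0 := by simpa using h.symm
  simpa using this

theorem IsLine.infinite {L : AffineSubspace ℝ Plane} (hL : IsLine L) :
    (L : Set Plane).Infinite := by
  obtain ⟨P, Q, h, hP, hQ⟩ := hL.exists_ne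
  have : Function.Injective (AffineMap.lineMap P Q : ℝ → Plane) := AffineMap.lineMap_injective ℝ h
  exact (Set.infinite_range_of_injective this).mono
    (by rintro _ ⟨r, rfl⟩; exact AffineMap.lineMap_mem r hP hQ)

theorem exists_coeff_of_totalDegree_le_one {f : Poly} (hf : f.totalDegree ≤ 1) :
    f = C (coeff (Finsupp.single 0 1) f) * X 0 + C (coeff (Finsupp.single 1 1) f) * X 1
      + C (coeff 0 f) := by
  ext d
  simp only [coeff_add, coeff_C_mul, coeff_C, coeff_X]
  by_cases hd : d.degree ≤ 1
  · have h2 : d 0 + d 1 ≤ 1 := by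
      simpa [Finsupp.degree_eq_sum, Fin.sum_univ_two] using hd
    have h3 : d = 0 ∨ d = Finsupp.single 0 1 ∨ d = Finsupp.single 1 1 := by
      rcases Nat.eq_zero_or_pos (d 0) with h0 | h0
      · rcases Nat.eq_zero_or_pos (d 1) with h1 | h1
        · left; ext i; fin_cases i <;> simp [h0, h1]
        · right; right; ext i; fin_cases i <;> simp [h0] ; omega
      · right; left; ext i; fin_cases i <;> simp <;> omega
    have e1 : (Finsupp.single 0 1 : Fin 2 →₀ ℕ) ≠ Finsupp.single 1 1 := by
      intro h; simpa using DFunLike.congr_fun h 0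
    have e2 : ∀ i : Fin 2, (Finsupp.single i 1 : Fin 2 →₀ ℕ) ≠ 0 := by
      intro i h; simpa using DFunLike.congr_fun h i
    rcases h3 with rfl | rfl | rfl <;> simp [e1, e1.symm, e2, (e2 _).symm]
  · have hc : coeff d f = 0 := by
      apply coeff_eq_zero_of_totalDegree_lt
      rw [Finsupp.degree_apply] at hd
      exact lt_of_le_of_lt hf (not_le.1 hd)
    have e2 : ∀ i : Fin 2, Finsupp.single i 1 ≠ d := by
      rintro i rfl; simp at hd
    have e0 : 0 ≠ d := by rintro rfl; simp at hd
    simp [hc, e2, e0]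

theorem exists_isEquationOf {f : Poly} (hf : f.totalDegree = 1) :
    ∃ L, IsLine L ∧ IsEquationOf f L := by
  obtain ⟨a, b, c, h⟩ : ∃ a b c : ℝ, f = C a * X 0 + C b * X 1 + C c :=
    ⟨_, _, _, exists_coeff_of_totalDegree_le_one hf.le⟩
  have hev : ∀ P : Plane, eval P f = a * P 0 + b * P 1 + c := by
    intro P; simp [h]
  have hs : a ^ 2 + b ^ 2 ≠ 0 := by
    intro h0
    have ha : a = 0 := by nlinarith
    have hb : b = 0 := by nlinarith
    simp [h, ha, hb] at hf
  -- The foot of the perpendicular from the origin; the line runs from it in the direction `(-b,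
  -- a)`.
  set P₀ : Plane := ![-c * a / (a ^ 2 + b ^ 2), -c * b / (a ^ 2 + b ^ 2)] with hP₀
  have hne : P₀ ≠ P₀ + ![-b, a] := by
    intro h0
    have h1 : (![-b, a] : Plane) = 0 := left_eq_add.1 h0
    have ha := congrFun h1 1
    have hb := congrFun h1 0
    simp at ha hb
    simp [ha, hb] at hs
  refine ⟨_, isLine_line hne, hf, fun P => ?_⟩
  rw [mem_affineSpan_pair_iff_exists_lineMap_eq, hev]
  constructor
  · rintro ⟨r, rfl⟩
    simp [AffineMap.lineMap_apply, hP₀]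
    field_simp
    ring
  · intro h0
    refine ⟨(a * P 1 - b * P 0) / (a ^ 2 + b ^ 2), ?_⟩
    ext i
    fin_cases i
    · simp [AffineMap.lineMap_apply, hP₀]
      field_simp
      linear_combination (-a) * h0
    · simp [AffineMap.lineMap_apply, hP₀]
      field_simp
      linear_combination (-b) * h0

theorem IsEquationOf.isLine {f : Poly} {L : AffineSubspace ℝ Plane} (h : IsEquationOf f L) :
    IsLine L := by
  obtain ⟨M, hM, hfM⟩ := exists_isEquationOf h.1
  have : L = M := by
    ext P
    rw [h.2, hfM.2]
  exact this ▸ hM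

theorem totalDegree_affine_le (a b c : ℝ) :
    (C a * X 0 + C b * X 1 + C c : Poly).totalDegree ≤ 1 := by
  refine (totalDegree_add _ _).trans (max_le ((totalDegree_add _ _).trans (max_le ?_ ?_)) ?_)
  · exact (totalDegree_mul _ _).trans (by simp)
  · exact (totalDegree_mul _ _).trans (by simp)
  · simp

theorem IsLine.exists_isEquationOf {L : AffineSubspace ℝ Plane} (hL : IsLine L) :
    ∃ f, IsEquationOf f L := by
  obtain ⟨P, Q, hPQ, hP, hQ⟩ := hL.exists_ne
  set f : Poly := C (Q 1 - P 1) * X 0 + C (-(Q 0 - P 0)) * X 1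
    + C (-(Q 1 - P 1) * P 0 + (Q 0 - P 0) * P 1) with hf
  have hev : ∀ R : Plane, eval R f = (Q 1 - P 1) * (R 0 - P 0) - (Q 0 - P 0) * (R 1 - P 1) := by
    intro R; simp [hf]; ring
  have hle : f.totalDegree ≤ 1 := totalDegree_affine_le _ _ _
  have h1 : f.totalDegree = 1 := by
    refine le_antisymm hle (Nat.one_le_iff_ne_zero.2 fun h0 => hPQ ?_)
    rw [totalDegree_eq_zero_iff_eq_C] at h0
    have e1 := hev P
    -- Moving from `P` along the normal changes the value of `f` by the squared length of `Q - P`,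
    -- so `f` is not constant.
    have e2 := hev ![P 0 + (Q 1 - P 1), P 1 - (Q 0 - P 0)]
    rw [h0, eval_C] at e1 e2
    simp at e1 e2
    rw [e1] at e2
    have h0 : Q 0 - P 0 = 0 := by nlinarith [sq_nonneg (Q 0 - P 0), sq_nonneg (Q 1 - P 1)]
    have h1 : Q 1 - P 1 = 0 := by nlinarith [sq_nonneg (Q 0 - P 0), sq_nonneg (Q 1 - P 1)]
    ext i
    fin_cases i
    · exact (sub_eq_zero.1 h0).symm
    · exact (sub_eq_zero.1 h1).symm
  obtain ⟨M, hM, hfM⟩ := GCSets.exists_isEquationOf h1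
  have : L = M := hL.eq_of_mem hM hPQ hP hQ ((hfM.2 P).2 (by rw [hev]; ring))
    ((hfM.2 Q).2 (by rw [hev]; ring))
  exact ⟨f, this ▸ hfM⟩

end GCSets

/-! ### Covers by lines and the removal of maximal lines -/

namespace GCSets

open scoped Classical

/-- The incidence content of the `GC_n` property: the nodes other than a given one are covered by
`n` lines not passing through it. -/
def GCLike (n : ℕ) (X : Finset Plane) : Prop :=
  X.card = (n + 2).choose 2 ∧ ∀ A ∈ X, ∃ f : Fin n → AffineSubspace ℝ Plane,
    (∀ i, IsLine (f i)) ∧ (∀ i, A ∉ f i) ∧ ∀ B ∈ X, B ≠ A → ∃ i, B ∈ f i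

/-- Pigeonhole: two of the points lie on the same covering line, which is then `L`. -/
theorem exists_eq_of_card_lt {n : ℕ} {f : Fin n → AffineSubspace ℝ Plane}
    (hf : ∀ i, IsLine (f i)) {L : AffineSubspace ℝ Plane} (hL : IsLine L) {S : Finset Plane}
    (hS : n < S.card) (hSL : ∀ P ∈ S, P ∈ L) (hcov : ∀ P ∈ S, ∃ i, P ∈ f i) : ∃ i, f i = L := by
  choose φ hφ using hcov
  obtain ⟨P, -, Q, -, hPQ, h⟩ := Finset.exists_ne_map_eq_of_card_lt_of_maps_to
    (s := S.attach) (t := (Finset.univ : Finset (Fin n))) (f := fun P => φ P.1 P.2)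
    (by simpa using hS) (by simp)
  have h' : φ P.1 P.2 = φ Q.1 Q.2 := h
  refine ⟨φ P.1 P.2, (hf _).eq_of_mem hL (fun h => hPQ (Subtype.ext h)) (hφ _ _) ?_
    (hSL _ P.2) (hSL _ Q.2)⟩
  rw [h']
  exact hφ _ _

theorem IsGC.gcLike {n : ℕ} {X : Finset Plane} (h : IsGC n X) : GCLike n X := by
  refine ⟨h.1.1, fun A hA => ?_⟩
  obtain ⟨p, ⟨hp, hpX⟩, -⟩ := h.1.2 (fun B => if B = A then 1 else 0)
  have hpA : MvPolynomial.eval A p = 1 := by simpa using hpX A hA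
  obtain ⟨f, hf, rfl⟩ := h.2 A hA p ⟨hp, hpA, fun B hB hBA => by simpa [hBA] using hpX B hB⟩
  choose L hL hfL using fun i => exists_isEquationOf (hf i)
  refine ⟨L, hL, fun i hi => ?_, fun B hB hBA => ?_⟩
  · rw [map_prod, Finset.prod_eq_zero (Finset.mem_univ i) (((hfL i).2 A).1 hi)] at hpA
    exact zero_ne_one hpA
  · have hB0 := hpX B hB
    rw [map_prod, if_neg hBA, Finset.prod_eq_zero_iff] at hB0
    obtain ⟨i, -, hi⟩ := hB0
    exact ⟨i, ((hfL i).2 B).2 hi⟩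

theorem GCLike.card_le {n : ℕ} {X : Finset Plane} (h : GCLike n X) {L : AffineSubspace ℝ Plane}
    (hL : IsLine L) : (X.filter (· ∈ L)).card ≤ n + 1 := by
  by_contra! hlt
  obtain ⟨A, hA⟩ := Finset.card_pos.1 (Nat.zero_lt_of_lt hlt)
  obtain ⟨f, hf, hAf, hcov⟩ := h.2 A (Finset.mem_filter.1 hA).1
  obtain ⟨i, rfl⟩ := exists_eq_of_card_lt hf hL (S := (X.filter (· ∈ L)).erase A)
    (by rw [Finset.card_erase_of_mem hA]; omega)
    (fun P hP => (Finset.mem_filter.1 (Finset.mem_of_mem_erase hP)).2)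
    (fun P hP => hcov P (Finset.mem_filter.1 (Finset.mem_of_mem_erase hP)).1
      (Finset.ne_of_mem_erase hP))
  exact hAf i (Finset.mem_filter.1 hA).2

/-- For a node off `L`, the `n + 2` nodes of `L` are covered by `n + 1` lines, so `L` is one of them
and can be dropped from the cover. -/
theorem GCLike.remove {n : ℕ} {X : Finset Plane} (h : GCLike (n + 1) X)
    {L : AffineSubspace ℝ Plane} (hL : IsLine L) (hc : n + 2 ≤ (X.filter (· ∈ L)).card) :
    GCLike n (X.filter (· ∉ L)) := by
  constructor
  · have h1 := h.card_le hL
    have h2 := Finset.card_filter_add_card_filter_not (s := X) (· ∈ L)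
    have h3 : (n + 1 + 2).choose 2 = (n + 2) + (n + 2).choose 2 := by
      rw [show n + 1 + 2 = (n + 2) + 1 from rfl, Nat.choose_succ_succ' (n + 2) 1, Nat.choose_one_right]
    rw [h.1, h3] at h2
    omega
  · intro A hA
    obtain ⟨hAX, hAL⟩ := Finset.mem_filter.1 hA
    obtain ⟨f, hf, hAf, hcov⟩ := h.2 A hAX
    obtain ⟨i, rfl⟩ := exists_eq_of_card_lt hf hL (S := X.filter (· ∈ L)) hc
      (fun P hP => (Finset.mem_filter.1 hP).2)
      (fun P hP => hcov P (Finset.mem_filter.1 hP).1 (fun h => hAL (h ▸ (Finset.mem_filter.1 hP).2)))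
    refine ⟨fun j => f (i.succAbove j), fun j => hf _, fun j => hAf _, fun B hB hBA => ?_⟩
    obtain ⟨hBX, hBL⟩ := Finset.mem_filter.1 hB
    obtain ⟨j, hj⟩ := hcov B hBX hBA
    obtain ⟨k, rfl⟩ := Fin.exists_succAbove_eq (x := j) (y := i) (fun h => hBL (h ▸ hj))
    exact ⟨k, hj⟩

theorem GCLike.remove_finset {n : ℕ} {X : Finset Plane} (h : GCLike n X)
    (T : Finset (AffineSubspace ℝ Plane))
    (hT : ∀ L ∈ T, IsLine L ∧ n + 1 ≤ (X.filter (· ∈ L)).card) (m : ℕ) (hm : m + T.card = n) :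
    GCLike m (X.filter fun P => ∀ L ∈ T, P ∉ L) := by
  induction T using Finset.induction_on generalizing m with
  | empty => simpa using (by simpa using hm : m = n) ▸ h
  | insert L T hLT ih =>
    rw [Finset.card_insert_of_notMem hLT] at hm
    obtain ⟨hL, hc⟩ := hT L (Finset.mem_insert_self L T)
    have h' := ih (fun M hM => hT M (Finset.mem_insert_of_mem hM)) (m + 1) (by omega)
    -- Each line of `T` takes at most one node away from `L`, so at least `n + 1 - T.card = m + 2`
    -- nodes of `L` survive, as many as `GCLike.remove` needs in degree `m + 1`.
    have hsub : X.filter (· ∈ L) ⊆ ((X.filter fun P => ∀ M ∈ T, P ∉ M).filter (· ∈ L)) ∪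
        T.biUnion fun M => X.filter fun P => P ∈ L ∧ P ∈ M := by
      intro P hP
      simp only [Finset.mem_filter, Finset.mem_union, Finset.mem_biUnion] at hP ⊢
      by_cases hPT : ∀ M ∈ T, P ∉ M
      · exact Or.inl ⟨⟨hP.1, hPT⟩, hP.2⟩
      · push Not at hPT
        obtain ⟨M, hM, hPM⟩ := hPT
        exact Or.inr ⟨M, hM, hP.1, hP.2, hPM⟩
    have hle : (T.biUnion fun M => X.filter fun P => P ∈ L ∧ P ∈ M).card ≤ T.card * 1 := by
      refine Finset.card_biUnion_le_card_mul _ _ _ fun M hM => Finset.card_le_one.2 ?_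
      intro P hP Q hQ
      simp only [Finset.mem_filter] at hP hQ
      by_contra hPQ
      exact hLT ((hL.eq_of_mem (hT M (Finset.mem_insert_of_mem hM)).1 hPQ hP.2.1 hQ.2.1 hP.2.2
        hQ.2.2) ▸ hM)
    have h1 := (Finset.card_le_card hsub).trans (Finset.card_union_le _ _)
    have h2 := h'.remove hL (by omega)
    convert h2 using 1
    ext P
    simp only [Finset.mem_filter, Finset.mem_insert, forall_eq_or_imp]
    tauto

theorem mem_maximalLines {n : ℕ} {X : Finset Plane} {L : AffineSubspace ℝ Plane} :
    L ∈ maximalLines n X ↔ IsLine L ∧ (X.filter (· ∈ L)).card = n + 1 := by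
  have : (X : Set Plane) ∩ (L : Set Plane) = ((X.filter (· ∈ L) : Finset Plane) : Set Plane) := by
    ext P; simp
  rw [maximalLines, Set.mem_ofPred_eq, this, Set.ncard_coe_finset]

section MaximalLines

variable {n : ℕ} {X : Finset Plane} {ι : Type} [Fintype ι]
  {lam : ι → AffineSubspace ℝ Plane}

theorem mem_mNodes_iff (hinj : Function.Injective lam) (hr : Set.range lam = maximalLines n X)
    {k : ℕ} {P : Plane} :
    P ∈ mNodes k n X ↔ P ∈ X ∧ (Finset.univ.filter fun a => P ∈ lam a).card = k := by
  have : {L | L ∈ maximalLines n X ∧ P ∈ L} =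
      lam '' ((Finset.univ.filter fun a => P ∈ lam a : Finset ι) : Set ι) := by
    rw [← hr]
    ext L
    simp only [Set.mem_ofPred_eq, Set.mem_range, Set.mem_image, Finset.coe_filter, Finset.mem_univ,
      true_and]
    constructor
    · rintro ⟨⟨a, rfl⟩, h⟩
      exact ⟨a, h, rfl⟩
    · rintro ⟨a, h, rfl⟩
      exact ⟨⟨a, rfl⟩, h⟩
  rw [mNodes, Set.mem_ofPred_eq, this, Set.ncard_image_of_injective _ hinj, Set.ncard_coe_finset]

theorem mem_mNodes_zero_iff (hinj : Function.Injective lam)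
    (hr : Set.range lam = maximalLines n X) {P : Plane} :
    P ∈ mNodes 0 n X ↔ P ∈ X ∧ ∀ a, P ∉ lam a := by
  rw [mem_mNodes_iff hinj hr, Finset.card_eq_zero, Finset.filter_eq_empty_iff]
  simp

theorem mem_mNodes_one_iff (hinj : Function.Injective lam)
    (hr : Set.range lam = maximalLines n X) {P : Plane} {a : ι} :
    P ∈ mNodes 1 n X ∧ P ∈ lam a ↔ P ∈ X ∧ P ∈ lam a ∧ ∀ b, b ≠ a → P ∉ lam b := by
  rw [mem_mNodes_iff hinj hr, Finset.card_eq_one]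
  constructor
  · rintro ⟨⟨hX, c, hc⟩, ha⟩
    have hac : a = c := by
      have : a ∈ Finset.univ.filter fun a => P ∈ lam a := by simpa using ha
      simpa [hc] using this
    refine ⟨hX, ha, fun b hb hPb => hb ?_⟩
    have : b ∈ Finset.univ.filter fun a => P ∈ lam a := by simpa using hPb
    rw [hc, Finset.mem_singleton] at this
    exact this.trans hac.symm
  · rintro ⟨hX, ha, hb⟩
    refine ⟨⟨hX, a, ?_⟩, ha⟩
    ext b
    simp only [Finset.mem_filter, Finset.mem_univ, true_and, Finset.mem_singleton]
    exact ⟨fun h => by_contra fun hba => hb b hba h, fun h => h ▸ ha⟩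

/-- The nodes outside all maximal lines with index not in `s`. -/
noncomputable def residual (X : Finset Plane) (lam : ι → AffineSubspace ℝ Plane) (s : Finset ι) :
    Finset Plane :=
  X.filter fun P => ∀ c, c ∉ s → P ∉ lam c

theorem mem_residual {s : Finset ι} {P : Plane} :
    P ∈ residual X lam s ↔ P ∈ X ∧ ∀ c, c ∉ s → P ∉ lam c := by
  simp [residual]

theorem GCLike.gcLike_residual (h : GCLike n X) (hinj : Function.Injective lam)
    (hr : Set.range lam = maximalLines n X) (s : Finset ι) {m : ℕ}
    (hm : m + Fintype.card ι = n + s.card) : GCLike m (residual X lam s) := by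
  have hs : s.card ≤ Fintype.card ι := Finset.card_le_univ s
  have h1 := h.remove_finset (sᶜ.image lam) (fun L hL => by
    obtain ⟨a, -, rfl⟩ := Finset.mem_image.1 hL
    obtain ⟨h1, h2⟩ := mem_maximalLines.1 (hr ▸ Set.mem_range_self a : lam a ∈ maximalLines n X)
    exact ⟨h1, h2.ge⟩) m (by
      rw [Finset.card_image_of_injective _ hinj, Finset.card_compl]; omega)
  convert h1 using 1
  ext P
  simp [residual]

end MaximalLines

end GCSets

/-! ### The triangle of `0_m`-nodes and a first naming -/

namespace GCSets

open scoped Classical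

section Triangle

variable {T : Fin 3 → Plane} {L : AffineSubspace ℝ Plane} {i j k : Fin 3}

theorem exists_third : ∀ i j : Fin 3, i ≠ j → ∃ k, k ≠ i ∧ k ≠ j := by decide

theorem exists_others : ∀ i : Fin 3, ∃ j k : Fin 3, j ≠ k ∧ j ≠ i ∧ k ≠ i := by decide

theorem add_one_ne : ∀ i : Fin 3, i + 1 ≠ i ∧ i + 2 ≠ i ∧ i + 1 ≠ i + 2 := by decide

theorem eq_or_eq_or_eq : ∀ i j k : Fin 3, i ≠ j → i ≠ k → j ≠ k → ∀ r, r = i ∨ r = j ∨ r = k := by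
  decide

theorem mem_oppositeLine (T : Fin 3 → Plane) (h : j ≠ i) : T j ∈ oppositeLine T i := by
  have : ∀ i j : Fin 3, j ≠ i → j = i + 1 ∨ j = i + 2 := by decide
  rcases this i j h with rfl | rfl
  · exact left_mem_affineSpan_pair ℝ _ _
  · exact right_mem_affineSpan_pair ℝ _ _

theorem isLine_oppositeLine (hT : Function.Injective T) (i : Fin 3) :
    IsLine (oppositeLine T i) :=
  isLine_line (hT.ne (by revert i; decide))

theorem IsLine.eq_oppositeLine (hL : IsLine L) (hT : Function.Injective T) (hij : i ≠ j)
    (hik : i ≠ k) (hjk : j ≠ k) (hi : T i ∈ L) (hj : T j ∈ L) : L = oppositeLine T k :=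
  hL.eq_of_mem (isLine_oppositeLine hT k) (hT.ne hij) hi hj (mem_oppositeLine T hik)
    (mem_oppositeLine T hjk)

theorem eq_vertex_of_mem (hT : Function.Injective T) (hnc : ∀ i, T i ∉ oppositeLine T i)
    (hij : i ≠ j) {P : Plane} (hi : P ∈ oppositeLine T i) (hj : P ∈ oppositeLine T j) :
    ∃ k, P = T k := by
  obtain ⟨k, hki, hkj⟩ := exists_third i j hij
  refine ⟨k, by_contra fun hP => hnc i ?_⟩
  rw [(isLine_oppositeLine hT i).eq_of_mem (isLine_oppositeLine hT j) hP hi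
    (mem_oppositeLine T hki) hj (mem_oppositeLine T hkj)]
  exact mem_oppositeLine T hij

end Triangle

theorem isLine_lam {n : ℕ} {X : Finset Plane} {ι : Type}
    {lam : ι → AffineSubspace ℝ Plane} (hr : Set.range lam = maximalLines n X) (a : ι) : IsLine (lam a) :=
  (mem_maximalLines.1 (hr ▸ Set.mem_range_self a : lam a ∈ maximalLines n X)).1

/-- For a `GCLike` set of defect three, a naming of the maximal lines and of the `0_m`- and
`1_m`-nodes in which the `1_m`-nodes on
`OO`-lines carry the numbers of these lines. -/
structure PreLabelling (n : ℕ) (X : Finset Plane) (ι : Type) [Fintype ι] where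
  gcLike : GCLike n X
  card_index : Fintype.card ι + 1 = n
  /-- The maximal lines. -/
  lam : ι → AffineSubspace ℝ Plane
  lam_injective : Function.Injective lam
  range_lam : Set.range lam = maximalLines n X
  /-- The nodes on no maximal line. -/
  O : Fin 3 → Plane
  O_injective : Function.Injective O
  mem_O : ∀ P, P ∈ Set.range O ↔ P ∈ X ∧ ∀ a, P ∉ lam a
  /-- The nodes on exactly one maximal line. -/
  A : ι → Fin 3 → Plane
  A_injective : ∀ a, Function.Injective (A a)
  mem_A : ∀ a P, P ∈ Set.range (A a) ↔ P ∈ X ∧ P ∈ lam a ∧ ∀ b, b ≠ a → P ∉ lam b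
  A_name : ∀ a r s, A a r ∈ oppositeLine O s → r = s

variable {n : ℕ} {X : Finset Plane} {ι : Type} [Fintype ι]

theorem GCLike.not_mem_oppositeLine (h : GCLike 1 X) {O : Fin 3 → Plane}
    (hO : Function.Injective O) (hr : ∀ P, P ∈ Set.range O ↔ P ∈ X) (i : Fin 3) :
    O i ∉ oppositeLine O i := by
  obtain ⟨f, hf, hif, hcov⟩ := h.2 (O i) ((hr _).1 ⟨i, rfl⟩)
  have hj : ∀ j, j ≠ i → O j ∈ f 0 := fun j hj => by
    obtain ⟨k, hk⟩ := hcov (O j) ((hr _).1 ⟨j, rfl⟩) (hO.ne hj)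
    rwa [Subsingleton.elim k 0] at hk
  obtain ⟨h1, h2, h3⟩ := add_one_ne i
  rw [← (hf 0).eq_oppositeLine hO h3 h1 h2 (hj _ h1) (hj _ h2)]
  exact hif 0

theorem residual_filter_mem {lam : ι → AffineSubspace ℝ Plane} (a : ι) (P : Plane) :
    P ∈ (residual X lam {a}).filter (· ∈ lam a) ↔
      P ∈ X ∧ P ∈ lam a ∧ ∀ b, b ≠ a → P ∉ lam b := by
  simp only [Finset.mem_filter, mem_residual, Finset.mem_singleton]
  tauto

theorem GCLike.card_residual_filter_mem (h : GCLike n X) (hc : Fintype.card ι + 1 = n)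
    {lam : ι → AffineSubspace ℝ Plane} (hinj : Function.Injective lam)
    (hr : Set.range lam = maximalLines n X) (a : ι) :
    ((residual X lam {a}).filter (· ∈ lam a)).card = 3 := by
  have h0 : (residual X lam ∅).card = 3 :=
    (h.gcLike_residual hinj hr ∅ (m := 1) (by simp; omega)).1
  have h1 : (residual X lam {a}).card = 6 :=
    (h.gcLike_residual hinj hr {a} (m := 2) (by simp; omega)).1
  have h2 := Finset.card_filter_add_card_filter_not (s := residual X lam {a}) (· ∈ lam a)
  have h3 : (residual X lam {a}).filter (· ∉ lam a) = residual X lam ∅ := by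
    ext P
    simp only [Finset.mem_filter, mem_residual, Finset.mem_singleton, Finset.notMem_empty,
      not_false_eq_true, true_implies]
    constructor
    · rintro ⟨⟨hX, h1⟩, h2⟩
      refine ⟨hX, fun c => ?_⟩
      by_cases hca : c = a
      · exact hca ▸ h2
      · exact h1 c hca
    · exact fun ⟨hX, h1⟩ => ⟨⟨hX, fun c _ => h1 c⟩, h1 a⟩
  rw [h3] at h2
  omega

theorem GCLike.exists_preLabelling (h : GCLike n X) (hc : Fintype.card ι + 1 = n)
    {lam : ι → AffineSubspace ℝ Plane} (hinj : Function.Injective lam)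
    (hr : Set.range lam = maximalLines n X) : Nonempty (PreLabelling n X ι) := by
  have h1 := h.gcLike_residual hinj hr ∅ (m := 1) (by simp; omega)
  let e := (Finset.equivFinOfCardEq (h1.1 : _ = 3)).symm
  let O : Fin 3 → Plane := fun i => e i
  have hO : Function.Injective O := Subtype.val_injective.comp e.injective
  have hmemO : ∀ P, P ∈ Set.range O ↔ P ∈ residual X lam ∅ := by
    intro P
    constructor
    · rintro ⟨i, rfl⟩
      exact (e i).2
    · intro hP
      exact ⟨e.symm ⟨P, hP⟩, by simp [O]⟩
  have hnc := h1.not_mem_oppositeLine hO hmemO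
  simp only [mem_residual, Finset.notMem_empty, not_false_eq_true, true_implies] at hmemO
  have hne : ∀ s a, oppositeLine O s ≠ lam a := by
    intro s a hs
    obtain ⟨j, -, -, hj, -⟩ := exists_others s
    exact ((hmemO _).1 ⟨j, rfl⟩).2 a (hs ▸ mem_oppositeLine O hj)
  have key : ∀ a, ∃ A : Fin 3 → Plane, Function.Injective A ∧
      (∀ P, P ∈ Set.range A ↔ P ∈ X ∧ P ∈ lam a ∧ ∀ b, b ≠ a → P ∉ lam b) ∧
      ∀ r s, A r ∈ oppositeLine O s → r = s := by
    intro a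
    set S := (residual X lam {a}).filter (· ∈ lam a) with hS
    have hSa : ∀ P ∈ S, P ∈ lam a := fun P hP => (Finset.mem_filter.1 hP).2
    set t : Finset (Fin 3) := Finset.univ.filter fun s => ∃ P ∈ S, P ∈ oppositeLine O s with ht
    -- The value `0` is taken only off `t`, where `f` is never consulted.
    let f : Fin 3 → Plane := fun s => if hs : ∃ P ∈ S, P ∈ oppositeLine O s then hs.choose else 0
    have hf : ∀ s ∈ t, f s ∈ S ∧ f s ∈ oppositeLine O s := by
      intro s hs
      have hs' := (Finset.mem_filter.1 hs).2
      simp only [f, dif_pos hs']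
      exact hs'.choose_spec
    -- Two OO-lines meet only at a `0_m`-node, which is not on `lam a`; so the names imposed by the
    -- OO-lines do not clash and extend to a bijection.
    obtain ⟨g, hg⟩ := Finset.exists_equiv_extend_of_card_eq (t := S) (s := t) (f := f)
      (by rw [h.card_residual_filter_mem hc hinj hr, Fintype.card_fin])
      (Finset.image_subset_iff.2 fun s hs => (hf s hs).1) (by
        intro r hr' s hs hrs
        by_contra hne'
        obtain ⟨k, hk⟩ := eq_vertex_of_mem hO hnc hne' (hf r hr').2 (hrs ▸ (hf s hs).2)
        exact ((hmemO _).1 ⟨k, rfl⟩).2 a (hk ▸ hSa _ (hf r hr').1))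
    refine ⟨fun r => g r, Subtype.val_injective.comp g.injective, fun P => ?_, fun r s hrs => ?_⟩
    · rw [← residual_filter_mem, ← hS]
      constructor
      · rintro ⟨i, rfl⟩
        exact (g i).2
      · intro hP
        exact ⟨g.symm ⟨P, hP⟩, by simp⟩
    · have hst : s ∈ t := Finset.mem_filter.2 ⟨Finset.mem_univ _, _, (g r).2, hrs⟩
      apply g.injective
      apply Subtype.ext
      rw [hg s hst]
      by_contra hP
      exact hne s a ((isLine_oppositeLine hO s).eq_of_mem (isLine_lam hr a) hP hrs (hf s hst).2
        (hSa _ (g r).2) (hSa _ (hf s hst).1))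
  choose A hA hmemA hname using key
  exact ⟨⟨h, hc, lam, hinj, hr, O, hO, hmemO, A, hA, hmemA, hname⟩⟩

end GCSets

/-! ### Incidences in the residual sets of 6 and 10 nodes -/

namespace GCSets

open scoped Classical

namespace PreLabelling

variable {n : ℕ} {X : Finset Plane} {ι : Type} [Fintype ι] (N : PreLabelling n X ι)

theorem isLine_lam (a : ι) : IsLine (N.lam a) := GCSets.isLine_lam N.range_lam a

theorem O_mem (i : Fin 3) : N.O i ∈ X := ((N.mem_O _).1 ⟨i, rfl⟩).1

theorem O_notMem_lam (i : Fin 3) (a : ι) : N.O i ∉ N.lam a := ((N.mem_O _).1 ⟨i, rfl⟩).2 a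

theorem A_mem (a : ι) (r : Fin 3) : N.A a r ∈ X := ((N.mem_A a _).1 ⟨r, rfl⟩).1

theorem A_mem_lam (a : ι) (r : Fin 3) : N.A a r ∈ N.lam a := ((N.mem_A a _).1 ⟨r, rfl⟩).2.1

theorem A_notMem_lam {a b : ι} (hab : b ≠ a) (r : Fin 3) : N.A a r ∉ N.lam b :=
  ((N.mem_A a _).1 ⟨r, rfl⟩).2.2 b hab

theorem A_ne_A {a b : ι} (hab : a ≠ b) (r s : Fin 3) : N.A a r ≠ N.A b s :=
  fun h => N.A_notMem_lam hab.symm r (h ▸ N.A_mem_lam b s)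

theorem O_ne_A (i : Fin 3) (a : ι) (r : Fin 3) : N.O i ≠ N.A a r :=
  fun h => N.O_notMem_lam i a (h ▸ N.A_mem_lam a r)

theorem gcLike_residual (s : Finset ι) : GCLike (s.card + 1) (residual X N.lam s) :=
  N.gcLike.gcLike_residual N.lam_injective N.range_lam s (by have := N.card_index; omega)

theorem isLine_oo (i : Fin 3) : IsLine (oppositeLine N.O i) := isLine_oppositeLine N.O_injective i

theorem O_notMem_oo (i : Fin 3) : N.O i ∉ oppositeLine N.O i := by
  refine (N.gcLike_residual ∅).not_mem_oppositeLine N.O_injective (fun P => ?_) i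
  rw [N.mem_O, mem_residual]
  simp

theorem oo_ne_lam (s : Fin 3) (a : ι) : oppositeLine N.O s ≠ N.lam a := by
  intro hs
  obtain ⟨j, -, -, hj, -⟩ := exists_others s
  exact N.O_notMem_lam j a (hs ▸ mem_oppositeLine N.O hj)

theorem eq_A_of_mem {a : ι} {s : Fin 3} (hs : N.A a s ∈ oppositeLine N.O s) {P : Plane}
    (hP : P ∈ oppositeLine N.O s) (hPa : P ∈ N.lam a) : P = N.A a s := by
  by_contra hne
  exact N.oo_ne_lam s a ((N.isLine_oo s).eq_of_mem (N.isLine_lam a) hne hP hs hPa (N.A_mem_lam a s))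

theorem eq_O_or_A {a : ι} {P : Plane} (hP : P ∈ X) (h : ∀ c, c ≠ a → P ∉ N.lam c) :
    (∃ i, P = N.O i) ∨ ∃ r, P = N.A a r := by
  by_cases ha : P ∈ N.lam a
  · obtain ⟨r, hr⟩ := (N.mem_A a P).2 ⟨hP, ha, h⟩
    exact Or.inr ⟨r, hr.symm⟩
  · obtain ⟨i, hi⟩ := (N.mem_O P).2 ⟨hP, fun c => by
      by_cases hc : c = a
      · exact hc ▸ ha
      · exact h c hc⟩
    exact Or.inl ⟨i, hi.symm⟩

theorem eq_O {P : Plane} (hP : P ∈ X) (h : ∀ c, P ∉ N.lam c) : ∃ i, P = N.O i := by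
  obtain ⟨i, hi⟩ := (N.mem_O P).2 ⟨hP, h⟩
  exact ⟨i, hi.symm⟩

theorem eq_O_or_A_or_mem {a b : ι} {P : Plane} (hP : P ∈ X)
    (h : ∀ c, c ≠ a → c ≠ b → P ∉ N.lam c) :
    (∃ i, P = N.O i) ∨ (∃ r, P = N.A a r) ∨ (∃ r, P = N.A b r) ∨ P ∈ N.lam a ∧ P ∈ N.lam b := by
  by_cases ha : P ∈ N.lam a
  · by_cases hb : P ∈ N.lam b
    · exact Or.inr (Or.inr (Or.inr ⟨ha, hb⟩))
    · rcases N.eq_O_or_A (a := a) hP (fun c hc => by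
        by_cases hcb : c = b
        · exact hcb ▸ hb
        · exact h c hc hcb) with h | h
      · exact Or.inl h
      · exact Or.inr (Or.inl h)
  · rcases N.eq_O_or_A (a := b) hP (fun c hc => by
        by_cases hca : c = a
        · exact hca ▸ ha
        · exact h c hca hc) with h | h
    · exact Or.inl h
    · exact Or.inr (Or.inr (Or.inl h))

/-- The two 6-node sets share at least the three `0_m`-nodes, so their union has at most 9 of the 10
nodes left by the other maximal lines. A tenth node must lie on both `lam a` and `lam b`. -/
theorem exists_meet {a b : ι} (hab : a ≠ b) : ∃ B ∈ X, B ∈ N.lam a ∧ B ∈ N.lam b ∧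
    ∀ c, c ≠ a → c ≠ b → B ∉ N.lam c := by
  have h0 : (residual X N.lam ∅).card = 3 := (N.gcLike_residual ∅).1
  have ha : (residual X N.lam {a}).card = 6 := (N.gcLike_residual {a}).1
  have hb : (residual X N.lam {b}).card = 6 := (N.gcLike_residual {b}).1
  have hab' : (residual X N.lam {a, b}).card = 10 := by
    have := (N.gcLike_residual {a, b}).1
    rwa [Finset.card_pair hab] at this
  have hinter : residual X N.lam ∅ ⊆ residual X N.lam {a} ∩ residual X N.lam {b} := by
    intro P
    simp only [Finset.mem_inter, mem_residual]
    exact fun ⟨hP, h⟩ => ⟨⟨hP, fun c _ => h c (by simp)⟩, hP, fun c _ => h c (by simp)⟩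
  have h1 := Finset.card_union_add_card_inter (residual X N.lam {a}) (residual X N.lam {b})
  have h2 := Finset.card_le_card hinter
  obtain ⟨B, hB, hB'⟩ := Finset.exists_mem_notMem_of_card_lt_card
    (s := residual X N.lam {a} ∪ residual X N.lam {b}) (t := residual X N.lam {a, b}) (by omega)
  simp only [Finset.mem_union, mem_residual, Finset.mem_insert, Finset.mem_singleton, not_or,
    not_and, not_forall, not_not, and_imp] at hB hB'
  obtain ⟨c, hca, hc⟩ := hB'.1 hB.1
  obtain ⟨d, hdb, hd⟩ := hB'.2 hB.1
  have hcb : c = b := by_contra fun h => hB.2 c hca h hc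
  have hda : d = a := by_contra fun h => hB.2 d h hdb hd
  exact ⟨B, hB.1, hda ▸ hd, hcb ▸ hc, hB.2⟩

theorem notMem_lam_of_mem {a b c : ι} (hab : a ≠ b) {P : Plane} (ha : P ∈ N.lam a)
    (hb : P ∈ N.lam b) (hca : c ≠ a) (hcb : c ≠ b) : P ∉ N.lam c := by
  obtain ⟨B, -, hBa, hBb, hB⟩ := N.exists_meet hab
  have : P = B := by
    by_contra hne
    exact hab (N.lam_injective ((N.isLine_lam a).eq_of_mem (N.isLine_lam b) hne ha hBa hb hBb))
  exact this ▸ hB c hca hcb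

theorem node_cases {P : Plane} (hP : P ∈ X) : (∃ i, P = N.O i) ∨ (∃ a r, P = N.A a r) ∨
    ∃ a b, a ≠ b ∧ P ∈ N.lam a ∧ P ∈ N.lam b := by
  by_cases h0 : ∀ a, P ∉ N.lam a
  · exact Or.inl (N.eq_O hP h0)
  push Not at h0
  obtain ⟨a, ha⟩ := h0
  by_cases h1 : ∀ b, b ≠ a → P ∉ N.lam b
  · rcases N.eq_O_or_A hP h1 with h | ⟨r, h⟩
    · exact Or.inl h
    · exact Or.inr (Or.inl ⟨a, r, h⟩)
  · push Not at h1
    obtain ⟨b, hb, hPb⟩ := h1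
    exact Or.inr (Or.inr ⟨a, b, hb.symm, ha, hPb⟩)

/-- Two lines cover the 6-node set without `A a r`. Neither is `lam a`, so each carries one of the
other two `1_m`-nodes; and one of them contains two `0_m`-nodes, so it is an OO-line. -/
theorem exists_mem_oo_of_ne (a : ι) (r : Fin 3) :
    ∃ s, s ≠ r ∧ N.A a s ∈ oppositeLine N.O s := by
  have hcov : GCLike 2 (residual X N.lam {a}) := N.gcLike_residual {a}
  have hA : ∀ s, N.A a s ∈ residual X N.lam {a} := fun s =>
    mem_residual.2 ⟨N.A_mem a s, fun c hc => N.A_notMem_lam (by simpa using hc) s⟩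
  obtain ⟨g, hg, hgA, hcov⟩ := hcov.2 (N.A a r) (hA r)
  have hO : ∀ i, ∃ m, N.O i ∈ g m := fun i =>
    hcov _ (mem_residual.2 ⟨N.O_mem i, fun c _ => N.O_notMem_lam i c⟩) (N.O_ne_A i a r)
  choose φ hφ using hO
  choose ψ hψ using fun s : {s // s ≠ r} => hcov _ (hA s) ((N.A_injective a).ne s.2)
  have hψi : Function.Injective ψ := by
    intro s t hst
    by_contra hne
    refine hgA (ψ s) ?_
    rw [(hg (ψ s)).eq_of_mem (N.isLine_lam a)
      ((N.A_injective a).ne fun h => hne (Subtype.ext h)) (hψ s) (hst ▸ hψ t)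
      (N.A_mem_lam _ _) (N.A_mem_lam _ _)]
    exact N.A_mem_lam a r
  have hψb : Function.Bijective ψ :=
    (Fintype.bijective_iff_injective_and_card ψ).2 ⟨hψi, by simp⟩
  obtain ⟨i, j, hij, hm⟩ := Fintype.exists_ne_map_eq_of_card_lt φ (by simp)
  obtain ⟨k, hki, hkj⟩ := exists_third i j hij
  have hoo : g (φ i) = oppositeLine N.O k :=
    (hg _).eq_oppositeLine N.O_injective hij hki.symm hkj.symm (hφ i) (hm ▸ hφ j)
  obtain ⟨⟨s, hs⟩, hsm⟩ := hψb.2 (φ i)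
  have h1 : N.A a s ∈ oppositeLine N.O k := by
    rw [← hoo, ← hsm]
    exact hψ ⟨s, hs⟩
  obtain rfl := N.A_name a s k h1
  exact ⟨s, hs, h1⟩

theorem mem_oo_of_notMem {a : ι} {r s : Fin 3} (hr : N.A a r ∉ oppositeLine N.O r)
    (hsr : s ≠ r) : N.A a s ∈ oppositeLine N.O s := by
  obtain ⟨t, htr, hts⟩ := exists_third r s hsr.symm
  obtain ⟨u, hut, hu⟩ := N.exists_mem_oo_of_ne a t
  rcases eq_or_eq_or_eq r s t hsr.symm htr.symm hts.symm u with rfl | rfl | rfl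
  · exact absurd hu hr
  · exact hu
  · exact absurd rfl hut

/-- Otherwise the OO-line has `n - 1` such nodes and two `0_m`-nodes, and would be maximal. -/
theorem exists_notMem_oo (s : Fin 3) : ∃ a, N.A a s ∉ oppositeLine N.O s := by
  by_contra! hall
  obtain ⟨h1, h2, h12⟩ := add_one_ne s
  have hsub : insert (N.O (s + 1)) (insert (N.O (s + 2)) (Finset.univ.image fun a => N.A a s)) ⊆
      X.filter (· ∈ oppositeLine N.O s) := by
    intro P hP
    simp only [Finset.mem_insert, Finset.mem_image, Finset.mem_univ, true_and] at hP
    rw [Finset.mem_filter]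
    rcases hP with rfl | rfl | ⟨a, rfl⟩
    · exact ⟨N.O_mem _, mem_oppositeLine N.O h1⟩
    · exact ⟨N.O_mem _, mem_oppositeLine N.O h2⟩
    · exact ⟨N.A_mem a s, hall a⟩
  have hcard : (insert (N.O (s + 1)) (insert (N.O (s + 2))
      (Finset.univ.image fun a => N.A a s))).card = n + 1 := by
    rw [Finset.card_insert_of_notMem, Finset.card_insert_of_notMem, Finset.card_image_of_injective,
      Finset.card_univ, N.card_index]
    · intro a b hab
      by_contra hne
      exact N.A_ne_A hne s s hab
    · simp only [Finset.mem_image, Finset.mem_univ, true_and, not_exists]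
      exact fun a => (N.O_ne_A _ a s).symm
    · simp only [Finset.mem_insert, Finset.mem_image, Finset.mem_univ, true_and, not_or, not_exists]
      exact ⟨N.O_injective.ne h12, fun a => (N.O_ne_A _ a s).symm⟩
  have hmax : oppositeLine N.O s ∈ maximalLines n X :=
    mem_maximalLines.2 ⟨N.isLine_oo s,
      le_antisymm (N.gcLike.card_le (N.isLine_oo s)) (hcard ▸ Finset.card_le_card hsub)⟩
  rw [← N.range_lam] at hmax
  obtain ⟨a, ha⟩ := hmax
  exact N.oo_ne_lam s a ha.symm

end PreLabelling

end GCSets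

/-! ### Each OO-line misses exactly one maximal line -/

namespace GCSets

open scoped Classical

namespace PreLabelling

variable {n : ℕ} {X : Finset Plane} {ι : Type} [Fintype ι] (N : PreLabelling n X ι)

/-- Three lines cover the 10-node set without the intersection node `B`. The `k`-th OO-line has four
of the nodes, so it is one of the three. Each of the other two carries one of `A a i`, `A a j` and
one of `A b i`, `A b j`; the required line is the one through `O k`. -/
theorem exists_line_of_notMem {a b : ι} (hab : a ≠ b) {i j k : Fin 3} (hij : i ≠ j) (hik : i ≠ k)
    (hjk : j ≠ k) (ha : N.A a i ∉ oppositeLine N.O i) (hb : N.A b j ∉ oppositeLine N.O j) :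
    ∃ M, IsLine M ∧ N.O k ∈ M ∧ N.A a i ∈ M ∧ N.A b j ∈ M := by
  obtain ⟨B, hBX, hBa, hBb, hB⟩ := N.exists_meet hab
  have hres : GCLike 3 (residual X N.lam {a, b}) := by
    have := N.gcLike_residual {a, b}
    rwa [Finset.card_pair hab] at this
  have hmem : ∀ {P : Plane}, P ∈ X → (∀ c, c ≠ a → c ≠ b → P ∉ N.lam c) →
      P ∈ residual X N.lam {a, b} := fun hP h => by
    simpa [mem_residual] using And.intro hP h
  obtain ⟨g, hg, hgB, hcov⟩ := hres.2 B (hmem hBX hB)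
  have hAB : ∀ r, N.A a r ≠ B := fun r h => N.A_notMem_lam hab.symm r (h ▸ hBb)
  have hBB : ∀ r, N.A b r ≠ B := fun r h => N.A_notMem_lam hab r (h ▸ hBa)
  have hOB : ∀ r, N.O r ≠ B := fun r h => N.O_notMem_lam r a (h ▸ hBa)
  choose φ hφ using fun r =>
    hcov _ (hmem (N.O_mem r) fun c _ _ => N.O_notMem_lam r c) (hOB r)
  choose p hp using fun r =>
    hcov _ (hmem (N.A_mem a r) fun c hc _ => N.A_notMem_lam hc r) (hAB r)
  choose q hq using fun r =>
    hcov _ (hmem (N.A_mem b r) fun c _ hc => N.A_notMem_lam hc r) (hBB r)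
  have hpi : ∀ r s, r ≠ s → p r ≠ p s := fun r s hrs h => hgB (p r) <| by
    rw [(hg (p r)).eq_of_mem (N.isLine_lam a) ((N.A_injective a).ne hrs) (hp r) (h ▸ hp s)
      (N.A_mem_lam a r) (N.A_mem_lam a s)]
    exact hBa
  have hqi : ∀ r s, r ≠ s → q r ≠ q s := fun r s hrs h => hgB (q r) <| by
    rw [(hg (q r)).eq_of_mem (N.isLine_lam b) ((N.A_injective b).ne hrs) (hq r) (h ▸ hq s)
      (N.A_mem_lam b r) (N.A_mem_lam b s)]
    exact hBb
  have hak := N.mem_oo_of_notMem ha hik.symm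
  have hbk := N.mem_oo_of_notMem hb hjk.symm
  obtain ⟨m, hm⟩ := exists_eq_of_card_lt (n := 3) hg (N.isLine_oo k)
    (S := {N.O i, N.O j, N.A a k, N.A b k}) (by
      rw [Finset.card_insert_of_notMem, Finset.card_insert_of_notMem, Finset.card_insert_of_notMem,
        Finset.card_singleton]
      · norm_num
      · simpa using N.A_ne_A hab k k
      · simp [N.O_ne_A]
      · simp [N.O_ne_A, N.O_injective.ne hij]) (by
      simp only [Finset.mem_insert, Finset.mem_singleton]
      rintro P (rfl | rfl | rfl | rfl)
      · exact mem_oppositeLine N.O hik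
      · exact mem_oppositeLine N.O hjk
      · exact hak
      · exact hbk) (by
      simp only [Finset.mem_insert, Finset.mem_singleton]
      rintro P (rfl | rfl | rfl | rfl)
      exacts [⟨_, hφ _⟩, ⟨_, hφ _⟩, ⟨_, hp _⟩, ⟨_, hq _⟩])
  have hφm : φ k ≠ m := fun h => N.O_notMem_oo k (hm ▸ h ▸ hφ k)
  have hpm : ∀ r, r ≠ k → p r ≠ m := fun r hr h => hr (N.A_name a r k (hm ▸ h ▸ hp r))
  have hqm : ∀ r, r ≠ k → q r ≠ m := fun r hr h => hr (N.A_name b r k (hm ▸ h ▸ hq r))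
  have fin3 : ∀ x y z m : Fin 3, x ≠ m → y ≠ m → z ≠ m → x ≠ y → x = z ∨ y = z := by decide
  have hp' := fin3 _ _ _ m (hpm i hik) (hpm j hjk) hφm (hpi i j hij)
  have hq' := fin3 _ _ _ m (hqm i hik) (hqm j hjk) hφm (hqi i j hij)
  -- With `A a j` on it, the line through `O k` would be the `j`-th OO-line, which contains neither
  -- `A b i` nor `A b j`. The claim `hqi'` is symmetric.
  have hpj : p j ≠ φ k := by
    intro h
    have e : g (φ k) = oppositeLine N.O j :=
      (hg _).eq_of_mem (N.isLine_oo j) (N.O_ne_A k a j) (hφ k) (h ▸ hp j)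
        (mem_oppositeLine N.O hjk.symm) (N.mem_oo_of_notMem ha hij.symm)
    rcases hq' with h' | h'
    · exact hij (N.A_name b i j (e ▸ h' ▸ hq i))
    · exact hb (e ▸ h' ▸ hq j)
  have hqi' : q i ≠ φ k := by
    intro h
    have e : g (φ k) = oppositeLine N.O i :=
      (hg _).eq_of_mem (N.isLine_oo i) (N.O_ne_A k b i) (hφ k) (h ▸ hq i)
        (mem_oppositeLine N.O hik.symm) (N.mem_oo_of_notMem hb hij)
    rcases hp' with h' | h'
    · exact ha (e ▸ h' ▸ hp i)
    · exact hij (N.A_name a j i (e ▸ h' ▸ hp j)).symm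
  exact ⟨g (φ k), hg _, hφ k, (hp'.resolve_right hpj) ▸ hp i, (hq'.resolve_left hqi') ▸ hq j⟩

/-- If `a` and `b` differ, the lines joining `O k` to the node missed by the `j`-th OO-line and `O
j` to the one missed by the `k`-th both contain `A a i` and `A b i`. So they coincide and form the
`i`-th OO-line, which misses `A a i`. -/
theorem eq_of_notMem_oo {a b : ι} {i : Fin 3} (ha : N.A a i ∉ oppositeLine N.O i)
    (hb : N.A b i ∉ oppositeLine N.O i) : a = b := by
  by_contra hab
  obtain ⟨j, k, hjk, hji, hki⟩ := exists_others i
  have hij := hji.symm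
  have hik := hki.symm
  obtain ⟨c, hc⟩ := N.exists_notMem_oo j
  obtain ⟨d, hd⟩ := N.exists_notMem_oo k
  have hac : a ≠ c := fun h => hc (h ▸ N.mem_oo_of_notMem ha hij.symm)
  have hbc : b ≠ c := fun h => hc (h ▸ N.mem_oo_of_notMem hb hij.symm)
  have had : a ≠ d := fun h => hd (h ▸ N.mem_oo_of_notMem ha hik.symm)
  have hbd : b ≠ d := fun h => hd (h ▸ N.mem_oo_of_notMem hb hik.symm)
  have hAA := N.A_ne_A hab i i
  obtain ⟨M₁, hM₁, hk₁, ha₁, hc₁⟩ := N.exists_line_of_notMem hac hij hik hjk ha hc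
  obtain ⟨M₂, hM₂, hk₂, hb₂, hc₂⟩ := N.exists_line_of_notMem hbc hij hik hjk hb hc
  obtain ⟨M₃, hM₃, hj₃, ha₃, hd₃⟩ := N.exists_line_of_notMem had hik hij hjk.symm ha hd
  obtain ⟨M₄, hM₄, hj₄, hb₄, hd₄⟩ := N.exists_line_of_notMem hbd hik hij hjk.symm hb hd
  have e12 : M₁ = M₂ := hM₁.eq_of_mem hM₂ (N.O_ne_A k c j) hk₁ hc₁ hk₂ hc₂
  have e34 : M₃ = M₄ := hM₃.eq_of_mem hM₄ (N.O_ne_A j d k) hj₃ hd₃ hj₄ hd₄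
  have e13 : M₁ = M₃ := hM₁.eq_of_mem hM₃ hAA ha₁ (e12 ▸ hb₂) ha₃ (e34 ▸ hb₄)
  have e := hM₁.eq_oppositeLine N.O_injective hjk hij.symm hik.symm (e13 ▸ hj₃) hk₁
  exact ha (e ▸ ha₁)

theorem exists_labelling (N : PreLabelling n X ι) (hn : 4 ≤ n) : Nonempty (Labelling n X) := by
  choose σ hσ using N.exists_notMem_oo
  have hσi : Function.Injective σ := by
    intro i j hij
    by_contra hne
    exact hσ j (hij ▸ N.mem_oo_of_notMem (hσ i) (Ne.symm hne))
  obtain ⟨e, he⟩ : ∃ e : Fin 3 ⊕ Fin (n - 4) ≃ ι, ∀ i, e (Sum.inl i) = σ i := by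
    obtain ⟨e, he⟩ := Finset.exists_equiv_extend_of_card_eq (α := Fin 3 ⊕ Fin (n - 4))
      (t := (Finset.univ : Finset ι)) (s := Finset.univ.image Sum.inl)
      (f := Sum.elim σ fun _ => σ 0)
      (by have := N.card_index; simp [Finset.card_univ]; omega) (Finset.subset_univ _) (by
        intro x hx y hy hxy
        simp only [Finset.coe_image, Finset.coe_univ, Set.image_univ, Set.mem_range] at hx hy
        obtain ⟨i, rfl⟩ := hx
        obtain ⟨j, rfl⟩ := hy
        exact congrArg _ (hσi hxy))
    exact ⟨e.trans (Equiv.subtypeUnivEquiv Finset.mem_univ), fun i =>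
      he _ (Finset.mem_image_of_mem _ (Finset.mem_univ i))⟩
  refine ⟨{
    lam := fun a => N.lam (e a)
    lam_injective := N.lam_injective.comp e.injective
    range_lam := by rw [← N.range_lam]; exact e.surjective.range_comp N.lam
    O := N.O
    O_injective := N.O_injective
    range_O := by
      ext P
      rw [N.mem_O, mem_mNodes_zero_iff N.lam_injective N.range_lam]
    A := fun a => N.A (e a)
    A_injective := fun a => N.A_injective _
    range_A := fun a => by
      ext P
      rw [N.mem_A, Set.mem_ofPred_eq, mem_mNodes_one_iff N.lam_injective N.range_lam]
    A_name := fun a => N.A_name _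
    lam_name := ?_ }⟩
  -- A `1_m`-node here would be the missed one. A node also on another `lam c` would be `A c i`,
  -- which lies on `lam c` alone.
  intro i P hPX hPo hPl
  rw [he] at hPl
  by_cases h : ∀ c, c ≠ σ i → P ∉ N.lam c
  · obtain ⟨r, rfl⟩ := (N.mem_A (σ i) P).2 ⟨hPX, hPl, h⟩
    exact hσ i (N.A_name _ _ _ hPo ▸ hPo)
  · push Not at h
    obtain ⟨c, hc, hPc⟩ := h
    have hci : N.A c i ∈ oppositeLine N.O i := by
      by_contra h'
      exact hc (N.eq_of_notMem_oo h' (hσ i))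
    exact N.A_notMem_lam hc.symm i (N.eq_A_of_mem hci hPo hPc ▸ hPl)

end PreLabelling

end GCSets

/-! ### From covers to fundamental polynomials and used lines -/

namespace GCSets

open scoped Classical
open MvPolynomial

/-- An equation of the line `L`. -/
noncomputable def eqn (L : AffineSubspace ℝ Plane) : Poly :=
  if h : ∃ f, IsEquationOf f L then h.choose else 0

theorem isEquationOf_eqn {L : AffineSubspace ℝ Plane} (hL : IsLine L) :
    IsEquationOf (eqn L) L := by
  have h := hL.exists_isEquationOf
  rw [eqn, dif_pos h]
  exact h.choose_spec

theorem eqn_ne_zero {L : AffineSubspace ℝ Plane} (hL : IsLine L) : eqn L ≠ 0 := by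
  intro h
  have := (isEquationOf_eqn hL).1
  simp [h] at this

theorem totalDegree_prod_eqn_le (T : Finset (AffineSubspace ℝ Plane)) (hT : ∀ L ∈ T, IsLine L) :
    (∏ L ∈ T, eqn L).totalDegree ≤ T.card := by
  refine (totalDegree_finsetProd _ _).trans ?_
  rw [Finset.card_eq_sum_ones]
  exact Finset.sum_le_sum fun L hL => (isEquationOf_eqn (hT L hL)).1.le

/-- An infinite line is not covered by finitely many lines that each meet it in at most one point.
-/
theorem IsLine.mem_of_covered {L : AffineSubspace ℝ Plane} (hL : IsLine L)
    {T : Finset (AffineSubspace ℝ Plane)} (hT : ∀ M ∈ T, IsLine M)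
    (hcov : ∀ P ∈ L, ∃ M ∈ T, P ∈ M) : L ∈ T := by
  by_contra hLT
  refine hL.infinite ((Set.Finite.biUnion T.finite_toSet fun M hM =>
    Set.Subsingleton.finite (s := {P | P ∈ L ∧ P ∈ M}) ?_).subset fun P hP => ?_)
  · rintro P ⟨hPL, hPM⟩ Q ⟨hQL, hQM⟩
    exact hL.eq_of_ne (hT M hM) (fun h => hLT (h ▸ hM)) hPL hPM hQL hQM
  · obtain ⟨M, hM, hPM⟩ := hcov P hP
    exact Set.mem_biUnion hM ⟨hP, hPM⟩

theorem IsCorrect.eq_zero {n : ℕ} {X : Finset Plane} (h : IsCorrect n X) {p : Poly}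
    (hp : p.totalDegree ≤ n) (h0 : ∀ A ∈ X, eval A p = 0) : p = 0 :=
  (h.2 fun _ => 0).unique ⟨hp, h0⟩ ⟨by simp, by simp⟩

theorem IsFundamental.unique {n : ℕ} {X : Finset Plane} (h : IsCorrect n X) {A : Plane}
    {p q : Poly} (hp : IsFundamental n X A p) (hq : IsFundamental n X A q) : p = q := by
  have : ∀ {r : Poly}, IsFundamental n X A r →
      r.totalDegree ≤ n ∧ ∀ B ∈ X, eval B r = if B = A then 1 else 0 := by
    intro r hr
    refine ⟨hr.1, fun B hB => ?_⟩
    split_ifs with hBA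
    · exact hBA ▸ hr.2.1
    · exact hr.2.2 B hB hBA
  exact (h.2 fun B => if B = A then 1 else 0).unique (this hp) (this hq)

/-- The normalised product of the equations is the fundamental polynomial. It vanishes on any used
line, so the lines of `T` cover that line and it is one of them. -/
theorem uses_iff_mem {n : ℕ} {X : Finset Plane} (h : IsCorrect n X) {P : Plane} (hP : P ∈ X)
    {T : Finset (AffineSubspace ℝ Plane)} (hTn : T.card ≤ n) (hT : ∀ L ∈ T, IsLine L)
    (hPT : ∀ L ∈ T, P ∉ L) (hcov : ∀ Q ∈ X, Q ≠ P → ∃ L ∈ T, Q ∈ L)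
    (L : AffineSubspace ℝ Plane) : Uses n X P L ↔ L ∈ T := by
  set c : ℝ := eval P (∏ L ∈ T, eqn L) with hc
  have hc0 : c ≠ 0 := by
    rw [hc, map_prod, Finset.prod_ne_zero_iff]
    exact fun L hL h0 => hPT L hL (((isEquationOf_eqn (hT L hL)).2 P).2 h0)
  have hfund : IsFundamental n X P (C c⁻¹ * ∏ L ∈ T, eqn L) := by
    refine ⟨?_, ?_, fun Q hQ hQP => ?_⟩
    · refine (totalDegree_mul _ _).trans ?_
      rw [totalDegree_C, zero_add]
      exact (totalDegree_prod_eqn_le T hT).trans hTn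
    · rw [map_mul, eval_C, ← hc, inv_mul_cancel₀ hc0]
    · obtain ⟨L, hL, hQL⟩ := hcov Q hQ hQP
      rw [map_mul, map_prod, Finset.prod_eq_zero hL (((isEquationOf_eqn (hT L hL)).2 Q).1 hQL),
        mul_zero]
  constructor
  · rintro ⟨-, p, f, q, hp, hf, -, hpfq⟩
    refine hf.isLine.mem_of_covered hT fun Q hQ => ?_
    have h0 : eval Q (C c⁻¹ * ∏ L ∈ T, eqn L) = 0 := by
      rw [← hp.unique h hfund, hpfq, map_mul, (hf.2 Q).1 hQ, zero_mul]
    rw [map_mul, eval_C, mul_eq_zero_iff_left (inv_ne_zero hc0), map_prod,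
      Finset.prod_eq_zero_iff] at h0
    obtain ⟨M, hM, hQM⟩ := h0
    exact ⟨M, hM, ((isEquationOf_eqn (hT M hM)).2 Q).2 hQM⟩
  · intro hL
    refine ⟨hP, _, eqn L, C c⁻¹ * ∏ M ∈ T.erase L, eqn M, hfund, isEquationOf_eqn (hT L hL), ?_, ?_⟩
    · have h1 := totalDegree_mul (C c⁻¹ : Poly) (∏ M ∈ T.erase L, eqn M)
      have h2 := totalDegree_prod_eqn_le (T.erase L) fun M hM => hT M (Finset.mem_of_mem_erase hM)
      have h3 := Finset.card_erase_add_one hL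
      rw [totalDegree_C] at h1
      omega
    · rw [← Finset.mul_prod_erase T eqn hL]
      ring

namespace PreLabelling

variable {n : ℕ} {X : Finset Plane} {ι : Type} [Fintype ι] (N : PreLabelling n X ι)

theorem uses_iff (h : IsCorrect n X) {P : Plane} (hP : P ∈ X) (s : Finset ι)
    (hPs : ∀ c, c ∉ s → P ∉ N.lam c) (E : Finset (AffineSubspace ℝ Plane))
    (hE : E.card ≤ s.card + 1) (hEl : ∀ L ∈ E, IsLine L) (hPE : ∀ L ∈ E, P ∉ L)
    (hcov : ∀ Q ∈ X, Q ≠ P → (∀ c, c ∉ s → Q ∉ N.lam c) → ∃ L ∈ E, Q ∈ L)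
    (L : AffineSubspace ℝ Plane) :
    Uses n X P L ↔ (∃ c, c ∉ s ∧ L = N.lam c) ∨ L ∈ E := by
  rw [uses_iff_mem h hP (T := sᶜ.image N.lam ∪ E)]
  · simp [eq_comm]
  · refine (Finset.card_union_le _ _).trans ?_
    rw [Finset.card_image_of_injective _ N.lam_injective, Finset.card_compl]
    have := N.card_index
    have := Finset.card_le_univ s
    omega
  · intro L hL
    rcases Finset.mem_union.1 hL with hL | hL
    · obtain ⟨c, -, rfl⟩ := Finset.mem_image.1 hL
      exact N.isLine_lam c
    · exact hEl L hL
  · intro L hL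
    rcases Finset.mem_union.1 hL with hL | hL
    · obtain ⟨c, hc, rfl⟩ := Finset.mem_image.1 hL
      exact hPs c (Finset.mem_compl.1 hc)
    · exact hPE L hL
  · intro Q hQ hQP
    by_cases hQs : ∀ c, c ∉ s → Q ∉ N.lam c
    · obtain ⟨L, hL, hQL⟩ := hcov Q hQ hQP hQs
      exact ⟨L, Finset.mem_union_right _ hL, hQL⟩
    · push Not at hQs
      obtain ⟨c, hc, hQc⟩ := hQs
      exact ⟨_, Finset.mem_union_left _ (Finset.mem_image_of_mem _ (Finset.mem_compl.2 hc)), hQc⟩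

/-- Unisolvence descends to the residual set: multiply `p` by equations of the maximal lines outside
`s`. -/
theorem eq_zero_of_residual (h : IsCorrect n X) (s : Finset ι) {p : Poly}
    (hp : p.totalDegree ≤ s.card + 1)
    (h0 : ∀ Q ∈ X, (∀ c, c ∉ s → Q ∉ N.lam c) → eval Q p = 0) : p = 0 := by
  have hl : ∀ L ∈ sᶜ.image N.lam, IsLine L := by
    intro L hL
    obtain ⟨c, -, rfl⟩ := Finset.mem_image.1 hL
    exact N.isLine_lam c
  have : (∏ L ∈ sᶜ.image N.lam, eqn L) * p = 0 := by
    refine h.eq_zero ?_ fun Q hQ => ?_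
    · have h1 := totalDegree_mul (∏ L ∈ sᶜ.image N.lam, eqn L) p
      have h2 := totalDegree_prod_eqn_le _ hl
      rw [Finset.card_image_of_injective _ N.lam_injective, Finset.card_compl] at h2
      have := N.card_index
      have := Finset.card_le_univ s
      omega
    · by_cases hQs : ∀ c, c ∉ s → Q ∉ N.lam c
      · rw [map_mul, h0 Q hQ hQs, mul_zero]
      · push Not at hQs
        obtain ⟨c, hc, hQc⟩ := hQs
        rw [map_mul, map_prod, Finset.prod_eq_zero
          (Finset.mem_image_of_mem _ (Finset.mem_compl.2 hc))
          (((isEquationOf_eqn (N.isLine_lam c)).2 Q).1 hQc), zero_mul]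
  refine (mul_eq_zero.1 this).resolve_left (Finset.prod_ne_zero_iff.2 fun L hL => ?_)
  exact eqn_ne_zero (hl L hL)

end PreLabelling

end GCSets

/-! ### Incidences and distinctness of the named lines -/

namespace GCSets

open scoped Classical
open MvPolynomial

/-- A naming as in `Labelling`, together with what is needed to work with it. -/
structure FullLabelling (n : ℕ) (X : Finset Plane) (κ : Type) [Fintype κ] extends
    PreLabelling n X (Fin 3 ⊕ κ) where
  isCorrect : IsCorrect n X
  notMem_oo : ∀ i, A (Sum.inl i) i ∉ oppositeLine O i

namespace FullLabelling

variable {n : ℕ} {X : Finset Plane} {κ : Type} [Fintype κ] (N : FullLabelling n X κ)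

/-- The `D`-nodes. -/
def D (i : Fin 3) : Plane := N.A (Sum.inl i) i

/-- The `OO`-lines. -/
def oo (i : Fin 3) : AffineSubspace ℝ Plane := oppositeLine N.O i

/-- The `DD`-lines. -/
def dd (i : Fin 3) : AffineSubspace ℝ Plane := oppositeLine N.D i

/-- The lines `ℓ_ij`. -/
def ell (i j : Fin 3) : AffineSubspace ℝ Plane :=
  line[ℝ, N.A (Sum.inl i) j, N.A (Sum.inl j) i]

/-- The lines `ℓ_i^j`. -/
def ellSup (i : Fin 3) (j : κ) : AffineSubspace ℝ Plane :=
  line[ℝ, N.D i, N.A (Sum.inr j) i]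

theorem isLine_oo (i : Fin 3) : IsLine (N.oo i) := isLine_oppositeLine N.O_injective i

theorem O_mem_oo {i j : Fin 3} (h : j ≠ i) : N.O j ∈ N.oo i := mem_oppositeLine N.O h

theorem O_notMem_oo (i : Fin 3) : N.O i ∉ N.oo i := N.toPreLabelling.O_notMem_oo i

theorem oo_injective : Function.Injective N.oo := by
  intro i j h
  by_contra hij
  exact N.O_notMem_oo i (h ▸ N.O_mem_oo hij)

theorem oo_ne_lam (i : Fin 3) (a : Fin 3 ⊕ κ) : N.oo i ≠ N.lam a := N.toPreLabelling.oo_ne_lam i a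

theorem D_mem (i : Fin 3) : N.D i ∈ N.lam (Sum.inl i) := N.A_mem_lam _ i

theorem A_mem_oo {a : Fin 3 ⊕ κ} {s : Fin 3} (h : a ≠ Sum.inl s) : N.A a s ∈ N.oo s := by
  by_contra hs
  exact h (N.eq_of_notMem_oo hs (N.notMem_oo s))

theorem A_inl_mem_oo {i j : Fin 3} (h : i ≠ j) : N.A (Sum.inl i) j ∈ N.oo j :=
  N.A_mem_oo (Sum.inl_injective.ne h)

theorem A_inr_mem_oo (i : Fin 3) (j : κ) : N.A (Sum.inr j) i ∈ N.oo i := N.A_mem_oo (by simp)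

theorem A_notMem_oo {a : Fin 3 ⊕ κ} {r s : Fin 3} (h : r ≠ s) : N.A a r ∉ N.oo s :=
  fun h' => h (N.A_name a r s h')

theorem D_notMem_oo (i k : Fin 3) : N.D i ∉ N.oo k := by
  intro h
  obtain rfl := N.A_name _ _ _ h
  exact N.notMem_oo _ h

theorem D_injective : Function.Injective N.D := by
  intro i j h
  by_contra hij
  exact N.A_ne_A (Sum.inl_injective.ne hij) i j h

theorem isLine_dd (i : Fin 3) : IsLine (N.dd i) := isLine_oppositeLine N.D_injective i

theorem D_mem_dd {i j : Fin 3} (h : j ≠ i) : N.D j ∈ N.dd i := mem_oppositeLine N.D h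

theorem O_mem_dd (i : Fin 3) : N.O i ∈ N.dd i := by
  obtain ⟨j, k, hjk, hji, hki⟩ := exists_others i
  obtain ⟨M, hM, hO, hj, hk⟩ := N.exists_line_of_notMem (Sum.inl_injective.ne hjk) hjk hji hki
    (N.notMem_oo j) (N.notMem_oo k)
  have : M = N.dd i := hM.eq_oppositeLine N.D_injective hjk hji hki hj hk
  exact this ▸ hO

theorem dd_ne_lam (i : Fin 3) (a : Fin 3 ⊕ κ) : N.dd i ≠ N.lam a :=
  fun h => N.O_notMem_lam i a (h ▸ N.O_mem_dd i)

theorem dd_ne_oo (i j : Fin 3) : N.dd i ≠ N.oo j := by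
  intro h
  obtain ⟨k, -, -, hk, -⟩ := exists_others i
  exact N.D_notMem_oo k j (h ▸ N.D_mem_dd hk)

/-- If the `D`-nodes were collinear, the three DD-lines would coincide and contain the whole
triangle of `0_m`-nodes. -/
theorem D_notMem_dd (i : Fin 3) : N.D i ∉ N.dd i := by
  intro h
  have hD : ∀ j, N.D j ∈ N.dd i := fun j => by
    by_cases hj : j = i
    · exact hj ▸ h
    · exact N.D_mem_dd hj
  have hO : ∀ j, N.O j ∈ N.dd i := fun j => by
    obtain ⟨k, l, hkl, hkj, hlj⟩ := exists_others j
    rw [(N.isLine_dd i).eq_oppositeLine N.D_injective hkl hkj hlj (hD _) (hD _)]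
    exact N.O_mem_dd j
  obtain ⟨k, l, hkl, hki, hli⟩ := exists_others i
  exact N.dd_ne_oo i i ((N.isLine_dd i).eq_oppositeLine N.O_injective hkl hki hli (hO _) (hO _))

theorem dd_injective : Function.Injective N.dd := by
  intro i j h
  by_contra hij
  exact N.D_notMem_dd i (h ▸ N.D_mem_dd hij)

theorem eq_D_of_mem_dd {i k : Fin 3} (hik : i ≠ k) {P : Plane} (hP : P ∈ N.dd k)
    (hPi : P ∈ N.lam (Sum.inl i)) : P = N.D i :=
  (N.isLine_dd k).eq_of_ne (N.isLine_lam _) (N.dd_ne_lam k _) hP hPi (N.D_mem_dd hik) (N.D_mem i)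

theorem eq_A_of_mem_oo {a : Fin 3 ⊕ κ} {s : Fin 3} (h : a ≠ Sum.inl s) {P : Plane}
    (hP : P ∈ N.oo s) (hPa : P ∈ N.lam a) : P = N.A a s :=
  N.eq_A_of_mem (N.A_mem_oo h) hP hPa

theorem isLine_ell {i j : Fin 3} (h : i ≠ j) : IsLine (N.ell i j) :=
  isLine_line (N.A_ne_A (Sum.inl_injective.ne h) _ _)

theorem left_mem_ell (i j : Fin 3) : N.A (Sum.inl i) j ∈ N.ell i j :=
  left_mem_affineSpan_pair ℝ _ _

theorem right_mem_ell (i j : Fin 3) : N.A (Sum.inl j) i ∈ N.ell i j :=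
  right_mem_affineSpan_pair ℝ _ _

theorem ell_comm (i j : Fin 3) : N.ell i j = N.ell j i := by
  rw [ell, ell, Set.pair_comm]

theorem ell_ne_lam {i j : Fin 3} (h : i ≠ j) (a : Fin 3 ⊕ κ) : N.ell i j ≠ N.lam a := by
  intro he
  have h1 : Sum.inl i = a := by
    by_contra hne
    exact N.A_notMem_lam (Ne.symm hne) _ (he ▸ N.left_mem_ell i j)
  have h2 : Sum.inl j = a := by
    by_contra hne
    exact N.A_notMem_lam (Ne.symm hne) _ (he ▸ N.right_mem_ell i j)
  exact h (Sum.inl_injective (h1.trans h2.symm))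

theorem eq_A_of_mem_ell {i j : Fin 3} (h : i ≠ j) {P : Plane} (hP : P ∈ N.ell i j)
    (hPi : P ∈ N.lam (Sum.inl i)) : P = N.A (Sum.inl i) j :=
  (N.isLine_ell h).eq_of_ne (N.isLine_lam _) (N.ell_ne_lam h _) hP hPi (N.left_mem_ell i j)
    (N.A_mem_lam _ _)

theorem isLine_ellSup (i : Fin 3) (j : κ) : IsLine (N.ellSup i j) :=
  isLine_line (N.A_ne_A (by simp) _ _)

theorem left_mem_ellSup (i : Fin 3) (j : κ) : N.D i ∈ N.ellSup i j :=
  left_mem_affineSpan_pair ℝ _ _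

theorem right_mem_ellSup (i : Fin 3) (j : κ) : N.A (Sum.inr j) i ∈ N.ellSup i j :=
  right_mem_affineSpan_pair ℝ _ _

theorem ellSup_ne_lam (i : Fin 3) (j : κ) (a : Fin 3 ⊕ κ) : N.ellSup i j ≠ N.lam a := by
  intro he
  have h1 : Sum.inl i = a := by
    by_contra hne
    exact N.A_notMem_lam (Ne.symm hne) _ (he ▸ N.left_mem_ellSup i j)
  have h2 : Sum.inr j = a := by
    by_contra hne
    exact N.A_notMem_lam (Ne.symm hne) _ (he ▸ N.right_mem_ellSup i j)
  exact Sum.inl_ne_inr (h1.trans h2.symm)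

theorem eq_D_of_mem_ellSup {i : Fin 3} {j : κ} {P : Plane} (hP : P ∈ N.ellSup i j)
    (hPi : P ∈ N.lam (Sum.inl i)) : P = N.D i :=
  (N.isLine_ellSup i j).eq_of_ne (N.isLine_lam _) (N.ellSup_ne_lam i j _) hP hPi
    (N.left_mem_ellSup i j) (N.D_mem i)

theorem oo_ne_ell (k : Fin 3) {i j : Fin 3} (h : i ≠ j) : N.oo k ≠ N.ell i j := by
  intro he
  have h1 := N.A_name _ _ k (show _ ∈ N.oo k from he ▸ N.left_mem_ell i j)
  have h2 := N.A_name _ _ k (show _ ∈ N.oo k from he ▸ N.right_mem_ell i j)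
  exact h (h2.trans h1.symm)

theorem oo_ne_ellSup (k i : Fin 3) (j : κ) : N.oo k ≠ N.ellSup i j :=
  fun he => N.D_notMem_oo i k (he ▸ N.left_mem_ellSup i j)

theorem dd_ne_ell (k : Fin 3) {i j : Fin 3} (h : i ≠ j) : N.dd k ≠ N.ell i j := by
  intro he
  by_cases hik : i = k
  · have h1 := N.eq_D_of_mem_dd (fun hjk : j = k => h (hik.trans hjk.symm))
      (he ▸ N.right_mem_ell i j) (N.A_mem_lam _ i)
    exact h (N.A_injective _ h1)
  · have h1 := N.eq_D_of_mem_dd hik (he ▸ N.left_mem_ell i j) (N.A_mem_lam _ j)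
    exact h (N.A_injective _ h1).symm

theorem dd_ne_ellSup (k i : Fin 3) (j : κ) : N.dd k ≠ N.ellSup i j := by
  intro he
  by_cases hik : i = k
  · subst hik
    exact N.D_notMem_dd i (he ▸ N.left_mem_ellSup i j)
  · exact N.dd_ne_oo k i ((N.isLine_dd k).eq_of_mem (N.isLine_oo i) (N.O_ne_A k _ i)
      (N.O_mem_dd k) (he ▸ N.right_mem_ellSup i j) (N.O_mem_oo (Ne.symm hik)) (N.A_inr_mem_oo i j))

theorem ellSup_injective {i i' : Fin 3} {j j' : κ} (h : N.ellSup i j = N.ellSup i' j') :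
    i = i' ∧ j = j' := by
  have hi : i = i' := by
    by_contra hne
    obtain ⟨k, hk, hk'⟩ := exists_third i i' hne
    exact N.dd_ne_ellSup k i j ((N.isLine_ellSup i j).eq_oppositeLine N.D_injective hne hk.symm
      hk'.symm (N.left_mem_ellSup i j) (h ▸ N.left_mem_ellSup i' j')).symm
  subst hi
  refine ⟨rfl, by_contra fun hne => N.oo_ne_ellSup i i j ?_⟩
  exact (N.isLine_oo i).eq_of_mem (N.isLine_ellSup i j)
    (N.A_ne_A (Sum.inr_injective.ne hne) i i) (N.A_inr_mem_oo i j) (N.A_inr_mem_oo i j')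
    (N.right_mem_ellSup i j) (h ▸ N.right_mem_ellSup i j')

theorem ell_ne_ell {i j k : Fin 3} (hij : i ≠ j) (hjk : j ≠ k) :
    N.ell i j ≠ N.ell i k := by
  intro h
  have h1 := N.eq_A_of_mem_ell hij (h ▸ N.left_mem_ell i k) (N.A_mem_lam _ k)
  exact hjk (N.A_injective _ h1).symm

theorem ell_injective {i j i' j' : Fin 3} (hij : i < j) (hij' : i' < j')
    (h : N.ell i j = N.ell i' j') : i = i' ∧ j = j' := by
  -- Any two of the three index pairs share an index, so these three inequalities cover all cases.
  have h01 := N.ell_ne_ell (i := 0) (j := 1) (k := 2) (by decide) (by decide)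
  have h02 := N.ell_ne_ell (i := 1) (j := 0) (k := 2) (by decide) (by decide)
  have h12 := N.ell_ne_ell (i := 2) (j := 0) (k := 1) (by decide) (by decide)
  rw [N.ell_comm 1 0] at h02
  rw [N.ell_comm 2 0, N.ell_comm 2 1] at h12
  fin_cases i <;> fin_cases j <;> (try exact absurd hij (by decide)) <;> fin_cases i' <;>
    fin_cases j' <;> (try exact absurd hij' (by decide)) <;>
    first
    | exact ⟨rfl, rfl⟩
    | exact absurd h h01
    | exact absurd h h02
    | exact absurd h h12
    | exact absurd h.symm h01
    | exact absurd h.symm h02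
    | exact absurd h.symm h12

end FullLabelling

end GCSets

/-! ### The third `D`-node is off `ell`; the lines used by each type of node -/

namespace GCSets

open scoped Classical
open MvPolynomial

theorem card_triple_le_card_pair {α : Type} [DecidableEq α] {a b : α} (hab : a ≠ b)
    (L₁ L₂ L₃ : AffineSubspace ℝ Plane) :
    ({L₁, L₂, L₃} : Finset _).card ≤ ({a, b} : Finset α).card + 1 := by
  rw [Finset.card_pair hab]
  exact Finset.card_le_three

namespace FullLabelling

variable {n : ℕ} {X : Finset Plane} {κ : Type} [Fintype κ] (N : FullLabelling n X κ)

theorem cases_of_residual_pair {a b : Fin 3 ⊕ κ} {Q : Plane} (hQ : Q ∈ X)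
    (h : ∀ c, c ∉ ({a, b} : Finset (Fin 3 ⊕ κ)) → Q ∉ N.lam c) :
    (∃ r, Q = N.O r) ∨ (∃ r, Q = N.A a r) ∨ (∃ r, Q = N.A b r) ∨ Q ∈ N.lam a ∧ Q ∈ N.lam b :=
  N.eq_O_or_A_or_mem hQ fun c hca hcb => h c (by simp [hca, hcb])

theorem eq_of_mem_lam {a b : Fin 3 ⊕ κ} (hab : a ≠ b) {P Q : Plane}
    (hP : P ∈ N.lam a ∧ P ∈ N.lam b) (hQ : Q ∈ N.lam a ∧ Q ∈ N.lam b) : P = Q :=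
  (N.isLine_lam a).eq_of_ne (N.isLine_lam b) (N.lam_injective.ne hab) hP.1 hP.2 hQ.1 hQ.2

/-- A point on two maximal lines is on no `OO`-line. -/
theorem notMem_oo_of_mem_lam {a b : Fin 3 ⊕ κ} (hab : a ≠ b) {P : Plane}
    (ha : P ∈ N.lam a) (hb : P ∈ N.lam b) (k : Fin 3) : P ∉ N.oo k := by
  intro hk
  by_cases hak : a = Sum.inl k
  · have hbk : b ≠ Sum.inl k := fun h => hab (hak.trans h.symm)
    exact N.A_notMem_lam hab k (N.eq_A_of_mem_oo hbk hk hb ▸ ha)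
  · exact N.A_notMem_lam hab.symm k (N.eq_A_of_mem_oo hak hk ha ▸ hb)

theorem notMem_dd_of_mem_lam {i k : Fin 3} (hik : i ≠ k) {b : Fin 3 ⊕ κ} (hb : b ≠ Sum.inl i)
    {P : Plane} (hPi : P ∈ N.lam (Sum.inl i)) (hPb : P ∈ N.lam b) : P ∉ N.dd k := by
  intro hk
  rw [N.eq_D_of_mem_dd hik hk hPi] at hPb
  exact N.A_notMem_lam hb i hPb

theorem notMem_ell_of_mem_lam {i j : Fin 3} (hij : i ≠ j) {P : Plane}
    (hPi : P ∈ N.lam (Sum.inl i)) (hPj : P ∈ N.lam (Sum.inl j)) : P ∉ N.ell i j := by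
  intro h
  exact N.A_notMem_lam (Sum.inl_injective.ne hij.symm) j (N.eq_A_of_mem_ell hij h hPi ▸ hPj)

theorem notMem_ellSup_of_mem_lam {i : Fin 3} {j : κ} {P : Plane}
    (hPi : P ∈ N.lam (Sum.inl i)) (hPj : P ∈ N.lam (Sum.inr j)) : P ∉ N.ellSup i j := by
  intro h
  rw [N.eq_D_of_mem_ellSup h hPi] at hPj
  exact N.A_notMem_lam Sum.inr_ne_inl i hPj

theorem A_inl_notMem_dd {i r k : Fin 3} (hir : i ≠ r) (hik : i ≠ k) :
    N.A (Sum.inl i) r ∉ N.dd k :=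
  fun h => hir (N.A_injective _ (N.eq_D_of_mem_dd hik h (N.A_mem_lam _ r))).symm

theorem totalDegree_eqn_mul_le {L₁ L₂ L₃ : AffineSubspace ℝ Plane} (h₁ : IsLine L₁)
    (h₂ : IsLine L₂) (h₃ : IsLine L₃) : (eqn L₁ * eqn L₂ * eqn L₃).totalDegree ≤ 3 := by
  have e₁ := totalDegree_mul (eqn L₁ * eqn L₂) (eqn L₃)
  have e₂ := totalDegree_mul (eqn L₁) (eqn L₂)
  rw [(isEquationOf_eqn h₁).1, (isEquationOf_eqn h₂).1] at e₂
  rw [(isEquationOf_eqn h₃).1] at e₁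
  omega

/-- In the 10-node set of `λ_i` and `λ_j`, the cubics `K₁`, `K₂`, `K₃` are, up to scalars, the
fundamental polynomials of `A_j^k`, `A_i^k` and the intersection node `B`. The cubic `P` vanishes at
the other seven nodes, so it is a combination of the three. If `D_k` were on `ell i j`, all three
would vanish at `D_k`, whereas `P` does not. -/
theorem D_notMem_ell {i j k : Fin 3} (hij : i ≠ j) (hik : i ≠ k) (hjk : j ≠ k) :
    N.D k ∉ N.ell i j := by
  intro hD
  have hab : (Sum.inl i : Fin 3 ⊕ κ) ≠ Sum.inl j := Sum.inl_injective.ne hij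
  obtain ⟨B, hBX, hBi, hBj, -⟩ := N.exists_meet hab
  have zl : ∀ a Q, Q ∈ N.lam a ↔ eval Q (eqn (N.lam a)) = 0 :=
    fun a => (isEquationOf_eqn (N.isLine_lam a)).2
  have zo : ∀ r Q, Q ∈ N.oo r ↔ eval Q (eqn (N.oo r)) = 0 :=
    fun r => (isEquationOf_eqn (N.isLine_oo r)).2
  have zd : ∀ r Q, Q ∈ N.dd r ↔ eval Q (eqn (N.dd r)) = 0 :=
    fun r => (isEquationOf_eqn (N.isLine_dd r)).2
  have ze : ∀ Q, Q ∈ N.ell i j ↔ eval Q (eqn (N.ell i j)) = 0 :=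
    (isEquationOf_eqn (N.isLine_ell hij)).2
  set P := eqn (N.oo i) * eqn (N.oo j) * eqn (N.dd k) with hP
  set K₁ := eqn (N.lam (Sum.inl i)) * eqn (N.dd i) * eqn (N.oo i) with hK₁
  set K₂ := eqn (N.lam (Sum.inl j)) * eqn (N.dd j) * eqn (N.oo j) with hK₂
  set K₃ := eqn (N.dd k) * eqn (N.ell i j) * eqn (N.oo k) with hK₃
  have n₁ : eval (N.A (Sum.inl j) k) K₁ ≠ 0 := by
    simp only [hK₁, map_mul, ne_eq, mul_eq_zero, ← zl, ← zo, ← zd, not_or]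
    exact ⟨⟨N.A_notMem_lam hab k, N.A_inl_notMem_dd hjk hij.symm⟩, N.A_notMem_oo hik.symm⟩
  have n₂ : eval (N.A (Sum.inl i) k) K₂ ≠ 0 := by
    simp only [hK₂, map_mul, ne_eq, mul_eq_zero, ← zl, ← zo, ← zd, not_or]
    exact ⟨⟨N.A_notMem_lam hab.symm k, N.A_inl_notMem_dd hik hij⟩, N.A_notMem_oo hjk.symm⟩
  have n₃ : eval B K₃ ≠ 0 := by
    simp only [hK₃, map_mul, ne_eq, mul_eq_zero, ← ze, ← zo, ← zd, not_or]
    exact ⟨⟨N.notMem_dd_of_mem_lam hik hab.symm hBi hBj, N.notMem_ell_of_mem_lam hij hBi hBj⟩,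
      N.notMem_oo_of_mem_lam hab hBi hBj k⟩
  have nP : eval (N.D k) P ≠ 0 := by
    simp only [hP, map_mul, ne_eq, mul_eq_zero, ← zo, ← zd, not_or]
    exact ⟨⟨N.D_notMem_oo k i, N.D_notMem_oo k j⟩, N.D_notMem_dd k⟩
  have e₁ : ∀ Q, (Q ∈ N.lam (Sum.inl i) ∨ Q ∈ N.dd i) ∨ Q ∈ N.oo i → eval Q K₁ = 0 := by
    intro Q hQ
    simpa only [hK₁, map_mul, mul_eq_zero, ← zl, ← zo, ← zd] using hQ
  have e₂ : ∀ Q, (Q ∈ N.lam (Sum.inl j) ∨ Q ∈ N.dd j) ∨ Q ∈ N.oo j → eval Q K₂ = 0 := by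
    intro Q hQ
    simpa only [hK₂, map_mul, mul_eq_zero, ← zl, ← zo, ← zd] using hQ
  have e₃ : ∀ Q, (Q ∈ N.dd k ∨ Q ∈ N.ell i j) ∨ Q ∈ N.oo k → eval Q K₃ = 0 := by
    intro Q hQ
    simpa only [hK₃, map_mul, mul_eq_zero, ← ze, ← zo, ← zd] using hQ
  have eP : ∀ Q, (Q ∈ N.oo i ∨ Q ∈ N.oo j) ∨ Q ∈ N.dd k → eval Q P = 0 := by
    intro Q hQ
    simpa only [hP, map_mul, mul_eq_zero, ← zo, ← zd] using hQ
  set a := eval (N.A (Sum.inl j) k) P / eval (N.A (Sum.inl j) k) K₁ with ha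
  set b := eval (N.A (Sum.inl i) k) P / eval (N.A (Sum.inl i) k) K₂ with hb
  set c := eval B P / eval B K₃ with hc
  have hev : ∀ Q, eval Q (P - C a * K₁ - C b * K₂ - C c * K₃) =
      eval Q P - a * eval Q K₁ - b * eval Q K₂ - c * eval Q K₃ := by
    intro Q; simp
  have hzero : P - C a * K₁ - C b * K₂ - C c * K₃ = 0 := by
    refine N.eq_zero_of_residual N.isCorrect {Sum.inl i, Sum.inl j} ?_ ?_
    · rw [Finset.card_pair hab]
      have hmul : ∀ (t : ℝ) (p : Poly), p.totalDegree ≤ 3 → (C t * p).totalDegree ≤ 3 := by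
        intro t p hp
        refine (totalDegree_mul _ _).trans ?_
        rwa [totalDegree_C, zero_add]
      refine (totalDegree_sub _ _).trans (max_le ((totalDegree_sub _ _).trans (max_le
        ((totalDegree_sub _ _).trans (max_le ?_ (hmul _ _ ?_))) (hmul _ _ ?_))) (hmul _ _ ?_))
      · exact totalDegree_eqn_mul_le (N.isLine_oo i) (N.isLine_oo j) (N.isLine_dd k)
      · exact totalDegree_eqn_mul_le (N.isLine_lam _) (N.isLine_dd i) (N.isLine_oo i)
      · exact totalDegree_eqn_mul_le (N.isLine_lam _) (N.isLine_dd j) (N.isLine_oo j)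
      · exact totalDegree_eqn_mul_le (N.isLine_dd k) (N.isLine_ell hij) (N.isLine_oo k)
    · intro Q hQ hQs
      rw [hev]
      rcases N.cases_of_residual_pair hQ hQs with ⟨r, rfl⟩ | ⟨r, rfl⟩ | ⟨r, rfl⟩ | hQ
      · rw [eP, e₁, e₂, e₃]
        · ring
        all_goals
          rcases eq_or_eq_or_eq i j k hij hik hjk r with rfl | rfl | rfl <;>
            simp [N.O_mem_dd, N.O_mem_oo, *, Ne.symm hij, Ne.symm hik, Ne.symm hjk]
      · rw [e₁ _ (Or.inl (Or.inl (N.A_mem_lam _ r)))]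
        rcases eq_or_eq_or_eq i j k hij hik hjk r with rfl | rfl | rfl
        · rw [show N.A (Sum.inl r) r = N.D r from rfl, eP _ (Or.inr (N.D_mem_dd hik)),
            e₂ _ (Or.inl (Or.inr (N.D_mem_dd hij))),
            e₃ _ (Or.inl (Or.inl (N.D_mem_dd hik)))]
          ring
        · rw [eP _ (Or.inl (Or.inr (N.A_inl_mem_oo hij))), e₂ _ (Or.inr (N.A_inl_mem_oo hij)),
            e₃ _ (Or.inl (Or.inr (N.left_mem_ell i r)))]
          ring
        · rw [e₃ _ (Or.inr (N.A_inl_mem_oo hik)), hb, div_mul_cancel₀ _ n₂]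
          ring
      · rw [e₂ _ (Or.inl (Or.inl (N.A_mem_lam _ r)))]
        rcases eq_or_eq_or_eq i j k hij hik hjk r with rfl | rfl | rfl
        · rw [eP _ (Or.inl (Or.inl (N.A_inl_mem_oo hij.symm))),
            e₁ _ (Or.inr (N.A_inl_mem_oo hij.symm)), e₃ _ (Or.inl (Or.inr (N.right_mem_ell r j)))]
          ring
        · rw [show N.A (Sum.inl r) r = N.D r from rfl, eP _ (Or.inr (N.D_mem_dd hjk)),
            e₁ _ (Or.inl (Or.inr (N.D_mem_dd hij.symm))),
            e₃ _ (Or.inl (Or.inl (N.D_mem_dd hjk)))]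
          ring
        · rw [e₃ _ (Or.inr (N.A_inl_mem_oo hjk)), ha, div_mul_cancel₀ _ n₁]
          ring
      · obtain rfl := N.eq_of_mem_lam hab hQ ⟨hBi, hBj⟩
        rw [e₁ _ (Or.inl (Or.inl hBi)), e₂ _ (Or.inl (Or.inl hBj)), hc, div_mul_cancel₀ _ n₃]
        ring
  have h0 := hev (N.D k)
  rw [hzero, map_zero, e₁ _ (Or.inl (Or.inr (N.D_mem_dd hik.symm))),
    e₂ _ (Or.inl (Or.inr (N.D_mem_dd hjk.symm))), e₃ _ (Or.inl (Or.inr hD))] at h0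
  exact nP (by linarith)

theorem ell_ne_ellSup {i j : Fin 3} (hij : i ≠ j) (k : Fin 3) (m : κ) :
    N.ell i j ≠ N.ellSup k m := by
  intro h
  have hk : N.D k ∈ N.ell i j := h ▸ N.left_mem_ellSup k m
  by_cases hki : k = i
  · subst hki
    exact hij (N.A_injective _ (N.eq_A_of_mem_ell hij hk (N.D_mem k)))
  by_cases hkj : k = j
  · subst hkj
    exact hij (N.A_injective _ (N.eq_A_of_mem_ell (Ne.symm hij) (N.ell_comm i k ▸ hk)
      (N.D_mem k))).symm
  exact N.D_notMem_ell hij (Ne.symm hki) (Ne.symm hkj) hk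

theorem uses_O_iff (i : Fin 3) (L : AffineSubspace ℝ Plane) :
    Uses n X (N.O i) L ↔ (∃ c, L = N.lam c) ∨ L = N.oo i := by
  rw [N.uses_iff N.isCorrect (N.O_mem i) ∅ (fun c _ => N.O_notMem_lam i c) {N.oo i} (by simp)]
  · simp
  · simpa using N.isLine_oo i
  · simpa using N.O_notMem_oo i
  · intro Q hQ hQi hQs
    obtain ⟨r, rfl⟩ := N.eq_O hQ (by simpa using hQs)
    exact ⟨_, Finset.mem_singleton_self _, N.O_mem_oo fun h => hQi (h ▸ rfl)⟩

theorem cases_of_residual_singleton {a : Fin 3 ⊕ κ} {Q : Plane} (hQ : Q ∈ X)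
    (h : ∀ c, c ∉ ({a} : Finset (Fin 3 ⊕ κ)) → Q ∉ N.lam c) :
    (∃ r, Q = N.O r) ∨ ∃ r, Q = N.A a r :=
  N.eq_O_or_A hQ fun c hca => h c (by simpa using hca)

theorem A_notMem_of_notMem_singleton (a : Fin 3 ⊕ κ) (r : Fin 3) (c : Fin 3 ⊕ κ)
    (hc : c ∉ ({a} : Finset (Fin 3 ⊕ κ))) : N.A a r ∉ N.lam c :=
  N.A_notMem_lam (by simpa using hc) r

/-- The case `a = Sum.inl r` is included, so this covers the `D`-nodes as well as the `1_m`-nodes of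
the nondistinguished lines. -/
theorem uses_A_iff {a : Fin 3 ⊕ κ} {r s t : Fin 3} (hrs : r ≠ s) (hrt : r ≠ t) (hst : s ≠ t)
    (hs : a ≠ Sum.inl s) (ht : a ≠ Sum.inl t) (L : AffineSubspace ℝ Plane) :
    Uses n X (N.A a r) L ↔ (∃ c, c ≠ a ∧ L = N.lam c) ∨ L = N.oo s ∨ L = N.oo t := by
  rw [N.uses_iff N.isCorrect (N.A_mem a r) {a} (N.A_notMem_of_notMem_singleton a r)
    {N.oo s, N.oo t} (Finset.card_insert_le _ _)]
  · simp
  · simp [N.isLine_oo]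
  · simp [N.A_notMem_oo hrs, N.A_notMem_oo hrt]
  · intro Q hQ hQr hQs
    simp only [Finset.mem_insert, Finset.mem_singleton, exists_eq_or_imp, exists_eq_left]
    rcases N.cases_of_residual_singleton hQ hQs with ⟨u, rfl⟩ | ⟨u, rfl⟩
    · by_cases hu : u = s
      · exact Or.inr (N.O_mem_oo (hu ▸ hst))
      · exact Or.inl (N.O_mem_oo hu)
    · rcases eq_or_eq_or_eq r s t hrs hrt hst u with rfl | rfl | rfl
      · exact absurd rfl hQr
      · exact Or.inl (N.A_mem_oo hs)
      · exact Or.inr (N.A_mem_oo ht)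

theorem uses_A_inl_iff {i r k : Fin 3} (hir : i ≠ r) (hik : i ≠ k) (hrk : r ≠ k)
    (L : AffineSubspace ℝ Plane) :
    Uses n X (N.A (Sum.inl i) r) L ↔
      (∃ c, c ≠ Sum.inl i ∧ L = N.lam c) ∨ L = N.oo k ∨ L = N.dd k := by
  rw [N.uses_iff N.isCorrect (N.A_mem _ r) {Sum.inl i} (N.A_notMem_of_notMem_singleton _ r)
    {N.oo k, N.dd k} (Finset.card_insert_le _ _)]
  · simp
  · simp [N.isLine_oo, N.isLine_dd]
  · simp [N.A_notMem_oo hrk, N.A_inl_notMem_dd hir hik]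
  · intro Q hQ hQr hQs
    simp only [Finset.mem_insert, Finset.mem_singleton, exists_eq_or_imp, exists_eq_left]
    rcases N.cases_of_residual_singleton hQ hQs with ⟨u, rfl⟩ | ⟨u, rfl⟩
    · by_cases hu : u = k
      · exact Or.inr (hu ▸ N.O_mem_dd u)
      · exact Or.inl (N.O_mem_oo hu)
    · rcases eq_or_eq_or_eq i r k hir hik hrk u with rfl | rfl | rfl
      · exact Or.inr (N.D_mem_dd hik)
      · exact absurd rfl hQr
      · exact Or.inl (N.A_inl_mem_oo hik)

theorem notMem_lam_of_notMem_pair {a b : Fin 3 ⊕ κ} (hab : a ≠ b) {P : Plane}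
    (ha : P ∈ N.lam a) (hb : P ∈ N.lam b) (c : Fin 3 ⊕ κ)
    (hc : c ∉ ({a, b} : Finset (Fin 3 ⊕ κ))) : P ∉ N.lam c := by
  simp only [Finset.mem_insert, Finset.mem_singleton, not_or] at hc
  exact N.notMem_lam_of_mem hab ha hb hc.1 hc.2

/-- The nine nodes to cover split as `O_i, O_j, A_i^k, A_j^k` on `oo k`, `O_k, D_i, D_j` on `dd k`,
and the remaining `A_i^j, A_j^i`, which span `ell i j`. -/
theorem uses_inl_inl_iff {i j k : Fin 3} (hij : i ≠ j) (hik : i ≠ k) (hjk : j ≠ k) {P : Plane}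
    (hP : P ∈ X) (hPi : P ∈ N.lam (Sum.inl i)) (hPj : P ∈ N.lam (Sum.inl j))
    (L : AffineSubspace ℝ Plane) :
    Uses n X P L ↔ (∃ c, c ∉ ({Sum.inl i, Sum.inl j} : Finset (Fin 3 ⊕ κ)) ∧ L = N.lam c) ∨
      L = N.oo k ∨ L = N.dd k ∨ L = N.ell i j := by
  have hab : (Sum.inl i : Fin 3 ⊕ κ) ≠ Sum.inl j := Sum.inl_injective.ne hij
  rw [N.uses_iff N.isCorrect hP _ (N.notMem_lam_of_notMem_pair hab hPi hPj)
    {N.oo k, N.dd k, N.ell i j} (card_triple_le_card_pair hab _ _ _)]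
  · simp
  · simp [N.isLine_oo, N.isLine_dd, N.isLine_ell hij]
  · simp [N.notMem_oo_of_mem_lam hab hPi hPj, N.notMem_dd_of_mem_lam hik hab.symm hPi hPj,
      N.notMem_ell_of_mem_lam hij hPi hPj]
  · intro Q hQ hQP hQs
    simp only [Finset.mem_insert, Finset.mem_singleton, exists_eq_or_imp, exists_eq_left]
    rcases N.cases_of_residual_pair hQ hQs with ⟨u, rfl⟩ | ⟨u, rfl⟩ | ⟨u, rfl⟩ | h
    · by_cases hu : u = k
      · exact Or.inr (Or.inl (hu ▸ N.O_mem_dd u))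
      · exact Or.inl (N.O_mem_oo hu)
    · rcases eq_or_eq_or_eq i j k hij hik hjk u with rfl | rfl | rfl
      · exact Or.inr (Or.inl (N.D_mem_dd hik))
      · exact Or.inr (Or.inr (N.left_mem_ell i u))
      · exact Or.inl (N.A_inl_mem_oo hik)
    · rcases eq_or_eq_or_eq i j k hij hik hjk u with rfl | rfl | rfl
      · exact Or.inr (Or.inr (N.right_mem_ell u j))
      · exact Or.inr (Or.inl (N.D_mem_dd hjk))
      · exact Or.inl (N.A_inl_mem_oo hjk)
    · exact absurd (N.eq_of_mem_lam hab h ⟨hPi, hPj⟩) hQP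

/-- The lines `oo s` and `oo t` cover all nine nodes but `D_i` and `A_j^i`, which span `ellSup i j`.
-/
theorem uses_inl_inr_iff {i s t : Fin 3} (his : i ≠ s) (hit : i ≠ t) (hst : s ≠ t) {j : κ}
    {P : Plane} (hP : P ∈ X) (hPi : P ∈ N.lam (Sum.inl i)) (hPj : P ∈ N.lam (Sum.inr j))
    (L : AffineSubspace ℝ Plane) :
    Uses n X P L ↔ (∃ c, c ∉ ({Sum.inl i, Sum.inr j} : Finset (Fin 3 ⊕ κ)) ∧ L = N.lam c) ∨
      L = N.oo s ∨ L = N.oo t ∨ L = N.ellSup i j := by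
  have hab : (Sum.inl i : Fin 3 ⊕ κ) ≠ Sum.inr j := Sum.inl_ne_inr
  rw [N.uses_iff N.isCorrect hP _ (N.notMem_lam_of_notMem_pair hab hPi hPj)
    {N.oo s, N.oo t, N.ellSup i j} (card_triple_le_card_pair hab _ _ _)]
  · simp
  · simp [N.isLine_oo, N.isLine_ellSup]
  · simp [N.notMem_oo_of_mem_lam hab hPi hPj, N.notMem_ellSup_of_mem_lam hPi hPj]
  · intro Q hQ hQP hQs
    simp only [Finset.mem_insert, Finset.mem_singleton, exists_eq_or_imp, exists_eq_left]
    rcases N.cases_of_residual_pair hQ hQs with ⟨u, rfl⟩ | ⟨u, rfl⟩ | ⟨u, rfl⟩ | h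
    · by_cases hu : u = s
      · exact Or.inr (Or.inl (N.O_mem_oo (hu ▸ hst)))
      · exact Or.inl (N.O_mem_oo hu)
    · rcases eq_or_eq_or_eq i s t his hit hst u with rfl | rfl | rfl
      · exact Or.inr (Or.inr (N.left_mem_ellSup u j))
      · exact Or.inl (N.A_inl_mem_oo his)
      · exact Or.inr (Or.inl (N.A_inl_mem_oo hit))
    · rcases eq_or_eq_or_eq i s t his hit hst u with rfl | rfl | rfl
      · exact Or.inr (Or.inr (N.right_mem_ellSup u j))
      · exact Or.inl (N.A_inr_mem_oo u j)
      · exact Or.inr (Or.inl (N.A_inr_mem_oo u j))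
    · exact absurd (N.eq_of_mem_lam hab h ⟨hPi, hPj⟩) hQP

theorem uses_inr_inr_iff {j m : κ} (hjm : j ≠ m) {P : Plane} (hP : P ∈ X)
    (hPj : P ∈ N.lam (Sum.inr j)) (hPm : P ∈ N.lam (Sum.inr m)) (L : AffineSubspace ℝ Plane) :
    Uses n X P L ↔ (∃ c, c ∉ ({Sum.inr j, Sum.inr m} : Finset (Fin 3 ⊕ κ)) ∧ L = N.lam c) ∨
      L = N.oo 0 ∨ L = N.oo 1 ∨ L = N.oo 2 := by
  have hab : (Sum.inr j : Fin 3 ⊕ κ) ≠ Sum.inr m := Sum.inr_injective.ne hjm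
  rw [N.uses_iff N.isCorrect hP _ (N.notMem_lam_of_notMem_pair hab hPj hPm)
    {N.oo 0, N.oo 1, N.oo 2} (card_triple_le_card_pair hab _ _ _)]
  · simp
  · simp [N.isLine_oo]
  · simp [N.notMem_oo_of_mem_lam hab hPj hPm]
  · intro Q hQ hQP hQs
    have : ∀ u, Q ∈ N.oo u → ∃ L ∈ ({N.oo 0, N.oo 1, N.oo 2} : Finset _), Q ∈ L := by
      intro u hu
      refine ⟨_, ?_, hu⟩
      fin_cases u <;> simp
    rcases N.cases_of_residual_pair hQ hQs with ⟨u, rfl⟩ | ⟨u, rfl⟩ | ⟨u, rfl⟩ | h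
    · obtain ⟨v, -, -, hv, -⟩ := exists_others u
      exact this v (N.O_mem_oo hv.symm)
    · exact this u (N.A_inr_mem_oo u j)
    · exact this u (N.A_inr_mem_oo u m)
    · exact absurd (N.eq_of_mem_lam hab h ⟨hPj, hPm⟩) hQP

theorem mem_usedLines_iff (L : AffineSubspace ℝ Plane) : L ∈ usedLines n X ↔
    (∃ c, L = N.lam c) ∨ (∃ i, L = N.oo i) ∨ (∃ i, L = N.dd i) ∨
      (∃ i j, i < j ∧ L = N.ell i j) ∨ ∃ i j, L = N.ellSup i j := by
  constructor
  · rintro ⟨P, hP⟩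
    rcases N.node_cases hP.1 with ⟨i, rfl⟩ | ⟨a, r, rfl⟩ | ⟨a, b, hab, ha, hb⟩
    · rcases (N.uses_O_iff i L).1 hP with h | h
      · exact Or.inl h
      · exact Or.inr (Or.inl ⟨i, h⟩)
    · obtain ⟨s, t, hst, hsr, htr⟩ := exists_others r
      by_cases hs : a = Sum.inl s
      · subst hs
        rcases (N.uses_A_inl_iff hsr hst htr.symm L).1 hP with ⟨c, -, h⟩ | h | h
        exacts [Or.inl ⟨c, h⟩, Or.inr (Or.inl ⟨t, h⟩), Or.inr (Or.inr (Or.inl ⟨t, h⟩))]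
      by_cases ht : a = Sum.inl t
      · subst ht
        rcases (N.uses_A_inl_iff htr hst.symm hsr.symm L).1 hP with ⟨c, -, h⟩ | h | h
        exacts [Or.inl ⟨c, h⟩, Or.inr (Or.inl ⟨s, h⟩), Or.inr (Or.inr (Or.inl ⟨s, h⟩))]
      rcases (N.uses_A_iff hsr.symm htr.symm hst hs ht L).1 hP with ⟨c, -, h⟩ | h | h
      exacts [Or.inl ⟨c, h⟩, Or.inr (Or.inl ⟨s, h⟩), Or.inr (Or.inl ⟨t, h⟩)]
    · have mixed : ∀ i j, P ∈ N.lam (Sum.inl i) → P ∈ N.lam (Sum.inr j) →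
          (∃ c, L = N.lam c) ∨ (∃ i, L = N.oo i) ∨ (∃ i, L = N.dd i) ∨
            (∃ i j, i < j ∧ L = N.ell i j) ∨ ∃ i j, L = N.ellSup i j := by
        intro i j hi hj
        obtain ⟨s, t, hst, hsi, hti⟩ := exists_others i
        rcases (N.uses_inl_inr_iff hsi.symm hti.symm hst hP.1 hi hj L).1 hP with
          ⟨c, -, h⟩ | h | h | h
        exacts [Or.inl ⟨c, h⟩, Or.inr (Or.inl ⟨s, h⟩), Or.inr (Or.inl ⟨t, h⟩),
          Or.inr (Or.inr (Or.inr (Or.inr ⟨i, j, h⟩)))]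
      rcases a with i | j <;> rcases b with i' | j'
      · have hii : i ≠ i' := fun h => hab (h ▸ rfl)
        obtain ⟨k, hki, hki'⟩ := exists_third i i' hii
        rcases (N.uses_inl_inl_iff hii hki.symm hki'.symm hP.1 ha hb L).1 hP with
          ⟨c, -, h⟩ | h | h | h
        · exact Or.inl ⟨c, h⟩
        · exact Or.inr (Or.inl ⟨k, h⟩)
        · exact Or.inr (Or.inr (Or.inl ⟨k, h⟩))
        · refine Or.inr (Or.inr (Or.inr (Or.inl ?_)))
          rcases lt_or_gt_of_ne hii with hlt | hlt
          · exact ⟨i, i', hlt, h⟩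
          · exact ⟨i', i, hlt, h.trans (N.ell_comm i i')⟩
      · exact mixed i j' ha hb
      · exact mixed i' j hb ha
      · have hjj : j ≠ j' := fun h => hab (h ▸ rfl)
        rcases (N.uses_inr_inr_iff hjj hP.1 ha hb L).1 hP with ⟨c, -, h⟩ | h | h | h
        exacts [Or.inl ⟨c, h⟩, Or.inr (Or.inl ⟨0, h⟩), Or.inr (Or.inl ⟨1, h⟩),
          Or.inr (Or.inl ⟨2, h⟩)]
  · rintro (⟨c, rfl⟩ | ⟨i, rfl⟩ | ⟨i, rfl⟩ | ⟨i, j, hij, rfl⟩ | ⟨i, j, rfl⟩)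
    · exact ⟨_, (N.uses_O_iff 0 _).2 (Or.inl ⟨c, rfl⟩)⟩
    · exact ⟨_, (N.uses_O_iff i _).2 (Or.inr rfl)⟩
    -- The `i`-th DD-line is used by `A_s^t`.
    · obtain ⟨s, t, hst, hsi, hti⟩ := exists_others i
      exact ⟨_, (N.uses_A_inl_iff hst hsi hti _).2 (Or.inr (Or.inr rfl))⟩
    · obtain ⟨k, hki, hkj⟩ := exists_third i j hij.ne
      obtain ⟨B, hB, hBi, hBj, -⟩ :=
        N.exists_meet (Sum.inl_injective.ne hij.ne : (Sum.inl i : Fin 3 ⊕ κ) ≠ Sum.inl j)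
      exact ⟨B, (N.uses_inl_inl_iff hij.ne hki.symm hkj.symm hB hBi hBj _).2
        (Or.inr (Or.inr (Or.inr rfl)))⟩
    · obtain ⟨s, t, hst, hsi, hti⟩ := exists_others i
      obtain ⟨B, hB, hBi, hBj, -⟩ :=
        N.exists_meet (Sum.inl_ne_inr : (Sum.inl i : Fin 3 ⊕ κ) ≠ Sum.inr j)
      exact ⟨B, (N.uses_inl_inr_iff hsi.symm hti.symm hst hB hBi hBj _).2
        (Or.inr (Or.inr (Or.inr rfl)))⟩

end FullLabelling

end GCSets

/-! ### Transfer to `Labelling` -/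

namespace GCSets

namespace Labelling

variable {n : ℕ} {X : Finset Plane}

/-- The naming `N`, together with the properties that follow from the `GC_n` property. -/
def toFull (N : Labelling n X) (hX : IsGC n X) (hn : 4 ≤ n) :
    FullLabelling n X (Fin (n - 4)) where
  gcLike := hX.gcLike
  card_index := by
    rw [Fintype.card_sum, Fintype.card_fin, Fintype.card_fin]
    omega
  lam := N.lam
  lam_injective := N.lam_injective
  range_lam := N.range_lam
  O := N.O
  O_injective := N.O_injective
  mem_O P := by rw [N.range_O, mem_mNodes_zero_iff N.lam_injective N.range_lam]
  A := N.A
  A_injective := N.A_injective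
  mem_A a P := by
    rw [N.range_A, Set.mem_ofPred_eq, mem_mNodes_one_iff N.lam_injective N.range_lam]
  A_name := N.A_name
  isCorrect := hX.1
  notMem_oo i h := by
    have hA : N.A (Sum.inl i) i ∈ {P | P ∈ mNodes 1 n X ∧ P ∈ N.lam (Sum.inl i)} :=
      N.range_A (Sum.inl i) ▸ Set.mem_range_self i
    exact N.lam_name i _ hA.1.1 h hA.2

theorem iUnion_lineClass (N : Labelling n X) (hX : IsGC n X) (hn : 4 ≤ n) :
    (⋃ c, N.lineClass c) = usedLines n X := by
  ext L
  rw [(N.toFull hX hn).mem_usedLines_iff, Set.mem_iUnion]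
  have h0 : L ∈ N.lineClass 0 ↔ ∃ c, L = N.lam c := by
    change L ∈ maximalLines n X ↔ _
    rw [← N.range_lam]
    exact exists_congr fun _ => eq_comm
  constructor
  · rintro ⟨c, hc⟩
    fin_cases c
    · exact Or.inl (h0.1 hc)
    · exact Or.inr (Or.inl hc)
    · exact Or.inr (Or.inr (Or.inl hc))
    · exact Or.inr (Or.inr (Or.inr (Or.inl hc)))
    · exact Or.inr (Or.inr (Or.inr (Or.inr hc)))
  · rintro (h | h | h | h | h)
    exacts [⟨0, h0.2 h⟩, ⟨1, h⟩, ⟨2, h⟩, ⟨3, h⟩, ⟨4, h⟩]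

theorem disjoint_lineClass (N : Labelling n X) (hX : IsGC n X) (hn : 4 ≤ n) {c c' : Fin 5}
    (h : c ≠ c') : Disjoint (N.lineClass c) (N.lineClass c') := by
  set F := N.toFull hX hn with hF
  have h0 : ∀ L ∈ N.lineClass 0, ∃ c, L = F.lam c := by
    intro L hL
    change L ∈ maximalLines n X at hL
    rw [← N.range_lam] at hL
    obtain ⟨c, rfl⟩ := hL
    exact ⟨c, rfl⟩
  have d01 : Disjoint (N.lineClass 0) (N.lineClass 1) := Set.disjoint_left.2 <| by
    rintro L hL ⟨i, rfl⟩
    obtain ⟨c, hc⟩ := h0 _ hL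
    exact F.oo_ne_lam i c hc
  have d02 : Disjoint (N.lineClass 0) (N.lineClass 2) := Set.disjoint_left.2 <| by
    rintro L hL ⟨i, rfl⟩
    obtain ⟨c, hc⟩ := h0 _ hL
    exact F.dd_ne_lam i c hc
  have d03 : Disjoint (N.lineClass 0) (N.lineClass 3) := Set.disjoint_left.2 <| by
    rintro L hL ⟨i, j, hij, rfl⟩
    obtain ⟨c, hc⟩ := h0 _ hL
    exact F.ell_ne_lam hij.ne c hc
  have d04 : Disjoint (N.lineClass 0) (N.lineClass 4) := Set.disjoint_left.2 <| by
    rintro L hL ⟨i, j, rfl⟩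
    obtain ⟨c, hc⟩ := h0 _ hL
    exact F.ellSup_ne_lam i j c hc
  have d12 : Disjoint (N.lineClass 1) (N.lineClass 2) := Set.disjoint_left.2 <| by
    rintro L ⟨i, rfl⟩ ⟨k, hk⟩
    exact F.dd_ne_oo k i hk.symm
  have d13 : Disjoint (N.lineClass 1) (N.lineClass 3) := Set.disjoint_left.2 <| by
    rintro L ⟨k, rfl⟩ ⟨i, j, hij, h⟩
    exact F.oo_ne_ell k hij.ne h
  have d14 : Disjoint (N.lineClass 1) (N.lineClass 4) := Set.disjoint_left.2 <| by
    rintro L ⟨k, rfl⟩ ⟨i, j, h⟩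
    exact F.oo_ne_ellSup k i j h
  have d23 : Disjoint (N.lineClass 2) (N.lineClass 3) := Set.disjoint_left.2 <| by
    rintro L ⟨k, rfl⟩ ⟨i, j, hij, h⟩
    exact F.dd_ne_ell k hij.ne h
  have d24 : Disjoint (N.lineClass 2) (N.lineClass 4) := Set.disjoint_left.2 <| by
    rintro L ⟨k, rfl⟩ ⟨i, j, h⟩
    exact F.dd_ne_ellSup k i j h
  have d34 : Disjoint (N.lineClass 3) (N.lineClass 4) := Set.disjoint_left.2 <| by
    rintro L ⟨i, j, hij, rfl⟩ ⟨k, m, h⟩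
    exact F.ell_ne_ellSup hij.ne k m h
  fin_cases c <;> fin_cases c' <;>
    first
    | exact absurd rfl h
    | assumption
    | exact Disjoint.symm (by assumption)

end Labelling

theorem IsGC.exists_labelling {n : ℕ} {X : Finset Plane} (hX : IsGC n X) (hn : 4 ≤ n)
    (hdef : defect n X = 3) : Nonempty (Labelling n X) := by
  have hcard : (maximalLines n X).ncard + 1 = n := by
    rw [defect] at hdef
    omega
  -- An infinite set has `ncard` zero, while here it is `n - 1 ≥ 3`.
  have hfin : (maximalLines n X).Finite := Set.finite_of_ncard_pos (by omega)
  have : Fintype (maximalLines n X) := hfin.fintype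
  rw [← Nat.card_coe_set_eq, Nat.card_eq_fintype_card] at hcard
  obtain ⟨N⟩ := hX.gcLike.exists_preLabelling hcard (lam := Subtype.val)
    Subtype.val_injective Subtype.range_val
  exact N.exists_labelling hn

end GCSets

theorem proposition5p1 (n : ℕ) (hn : 4 ≤ n) (X : Finset GCSets.Plane)
    (hX : GCSets.IsGC n X) (hdef : GCSets.defect n X = 3) :
    -- the names exist
    Nonempty (GCSets.Labelling n X) ∧
    ∀ N : GCSets.Labelling n X,
      -- the nodes and lines named in the descriptions of the classes lie as described
      (∀ i j, i ≠ j → N.A (Sum.inl i) j ∈ N.oo j) ∧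
      (∀ i j, N.A (Sum.inr j) i ∈ N.oo i) ∧
      (∀ i k, N.D i ∉ N.oo k) ∧
      (∀ i, N.O i ∈ N.dd i) ∧
      -- the five classes make up the set of used lines
      (⋃ c, N.lineClass c) = GCSets.usedLines n X ∧
      -- the five classes are pairwise disjoint
      (∀ c c', c ≠ c' → Disjoint (N.lineClass c) (N.lineClass c')) ∧
      -- within each class, distinct labels give distinct lines
      (∀ a b, N.lam a = N.lam b → a = b) ∧
      (∀ i i', N.oo i = N.oo i' → i = i') ∧
      (∀ i i', N.dd i = N.dd i' → i = i') ∧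
      (∀ i j i' j', i < j → i' < j' → N.ell i j = N.ell i' j' → i = i' ∧ j = j') ∧
      (∀ i j i' j', N.ellSup i j = N.ellSup i' j' → i = i' ∧ j = j') ∧
      -- the line `ℓ_ij` does not pass through the third `D`-node
      (∀ i j k, i ≠ j → i ≠ k → j ≠ k → N.D k ∉ N.ell i j) := by
  refine ⟨hX.exists_labelling hn hdef, fun N => ?_⟩
  let F := N.toFull hX hn
  exact ⟨fun _ _ h => F.A_inl_mem_oo h, fun i j => F.A_inr_mem_oo i j, F.D_notMem_oo, F.O_mem_dd,
    N.iUnion_lineClass hX hn, fun _ _ h => N.disjoint_lineClass hX hn h,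
    fun _ _ h => N.lam_injective h, fun _ _ h => F.oo_injective h, fun _ _ h => F.dd_injective h,
    fun _ _ _ _ h h' e => F.ell_injective h h' e, fun _ _ _ _ e => F.ellSup_injective e,
    fun _ _ _ h h' h'' => F.D_notMem_ell h h' h''⟩
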